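/- Call a map $f:\mathbb C\to\mathbb C$ \emph{$K$-quasiconformal} if it is an orientation preserving homeomorphism of $\mathbb C$ belonging to $W^{1,2}_{\mathrm{loc}}(\mathbb C)$ whose weak directional derivatives satisfy $\max_{u}|\partial_{u} f|\le K\min_{u}|\partial_{u} f|$ almost everywhere ($u$ ranging over the unit directions), and \emph{principal} if $f(z)=z+O(1/z)$ as $|z|\to\infty$. For a principal $K$-quasiconformal map $f$, a point $z_0$ and $r>0$, let $\arg(f(z_0+r)-f(z_0))$ be the value at $r$ of the continuous choice, along the ray $\{z_0+t: t>0\}$, of the argument of $f(z_0+t)-f(z_0)$ that tends to $0$ as $t\to\infty$ (the total rotation about $f(z_0)$ of the image of $[z_0+r,\infty)$). We say that $f$ \emph{stretches like $\alpha$ and rotates like $\gamma$ at $z_0$} if there are scales $r_n>0$ decreasing to $0$ with $$\lim_{n\to\infty}\frac{\log|f(z_0+r_n)-f(z_0)|}{\log r_n}=\alpha\qquad\text{and}\qquad \lim_{n\to\infty}\frac{\arg(f(z_0+r_n)-f(z_0))}{\log|f(z_0+r_n)-f(z_0)|}=\gamma .$$ \textbf{Theorem.} Let $K,\alpha,\gamma$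 be real numbers such that the map $z\mapsto z|z|^{\alpha(1+i\gamma)-1}$ (with value $0$ at $0$) is $K$-quasiconformal. Then there are a principal $K$-quasiconformal map $f:\mathbb C\to\mathbb C$ and an uncountable set $E\subset\mathbb C$ such that $f$ stretches like $\alpha$ and rotates like $\gamma$ at every point of $E$. -/

import Mathlib

open MeasureTheory Filter Topology
open scoped ContDiff

namespace QCMap

/-- `D` is a weak (distributional) derivative of `f : ℂ → ℂ`: integration by parts holds against
every real-valued smooth compactly supported test function, in every direction. -/
def IsWeakDeriv (f : ℂ → ℂ) (D : ℂ → ℂ →L[ℝ] ℂ) : Prop :=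
  ∀ φ : ℂ → ℝ, ContDiff ℝ ∞ φ → HasCompactSupport φ → ∀ v : ℂ,
    ∫ z, (fderiv ℝ φ z v) • f z = - ∫ z, φ z • D z v

/-- Local square integrability with respect to Lebesgue measure on the plane. -/
def LocallyL2 {E : Type*} [NormedAddCommGroup E] (g : ℂ → E) : Prop :=
  ∀ C : Set ℂ, IsCompact C → MemLp g 2 (volume.restrict C)

/-- `f` belongs to the Sobolev space `W^{1,2}_loc(ℂ)`, with weak derivative `D`. -/
structure IsW12LocWith (f : ℂ → ℂ) (D : ℂ → ℂ →L[ℝ] ℂ) : Prop where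
  locallyL2 : LocallyL2 f
  locallyL2_deriv : LocallyL2 D
  weakDeriv : IsWeakDeriv f D

/-- A homeomorphism `f` of the plane preserves orientation: when `z` runs once counterclockwise
around a circle centered at `z₀`, a continuous argument `θ` of `f z - f z₀` increases by `2π`, i.e.
the image of the circle has winding number `+1` about `f z₀`. -/
def OrientationPreserving (f : ℂ → ℂ) : Prop :=
  ∀ (z₀ : ℂ) (ρ : ℝ), 0 < ρ → ∃ θ : ℝ → ℝ, Continuous θ ∧
    (∀ t : ℝ, f (circleMap z₀ ρ t) - f z₀ =
      (‖f (circleMap z₀ ρ t) - f z₀‖ : ℂ) * Complex.exp (θ t * Complex.I)) ∧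
    θ (2 * Real.pi) - θ 0 = 2 * Real.pi

/-- `K`-quasiconformal self-maps of the plane: orientation preserving homeomorphisms in
`W^{1,2}_loc` with `max_u |∂_u f| ≤ K min_v |∂_v f|` almost everywhere, where `u, v` range over
all unit directions. -/
structure IsQuasiconformal (K : ℝ) (f : ℂ → ℂ) : Prop where
  isHomeomorph : IsHomeomorph f
  orientationPreserving : OrientationPreserving f
  distortion : ∃ D : ℂ → ℂ →L[ℝ] ℂ, IsW12LocWith f D ∧
    ∀ᵐ z : ℂ, ∀ u v : ℂ, ‖u‖ = 1 → ‖v‖ = 1 → ‖D z u‖ ≤ K * ‖D z v‖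

/-- `f z = z + O(1 / z)` as `|z| → ∞`. -/
def IsPrincipal (f : ℂ → ℂ) : Prop :=
  (fun z : ℂ => f z - z) =O[Bornology.cobounded ℂ] (fun z : ℂ => z⁻¹)

/-- The map `z ↦ z |z| ^ (α (1 + i γ) - 1)`, with value `0` at `0`. -/
noncomputable def powerMap (α γ : ℝ) (z : ℂ) : ℂ :=
  z * (‖z‖ : ℂ) ^ ((α : ℂ) * (1 + Complex.I * γ) - 1)

/-- `θ r` is `arg (f (z₀ + r) - f z₀)`, the total rotation about `f z₀` of the image of the ray
`[z₀ + r, ∞)`: the continuous choice of the argument along the ray that tends to `0` at infinity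
(for a principal map, `f (z₀ + r) - f z₀` is asymptotic to the positive number `r`). For an
injective continuous principal `f` there is exactly one such function on `(0, ∞)`. -/
structure IsRayArg (f : ℂ → ℂ) (z₀ : ℂ) (θ : ℝ → ℝ) : Prop where
  continuousOn : ContinuousOn θ (Set.Ioi 0)
  arg_eq : ∀ r : ℝ, 0 < r → f (z₀ + r) - f z₀ =
    (‖f (z₀ + r) - f z₀‖ : ℂ) * Complex.exp (θ r * Complex.I)
  tendsto_zero : Tendsto θ atTop (𝓝 0)

/-- A sequence of scales decreasing to zero. -/
structure IsScaleSeq (r : ℕ → ℝ) : Prop where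
  pos : ∀ n, 0 < r n
  strictAnti : StrictAnti r
  tendsto_zero : Tendsto r atTop (𝓝 0)

/-- `f` stretches with exponent `α` at `z₀` along the scales `r n`. -/
def StretchesAlong (f : ℂ → ℂ) (α : ℝ) (z₀ : ℂ) (r : ℕ → ℝ) : Prop :=
  Tendsto (fun n => Real.log ‖f (z₀ + r n) - f z₀‖ / Real.log (r n)) atTop (𝓝 α)

/-- `f` rotates with exponent `γ` at `z₀` along the scales `r n`. -/
def RotatesAlong (f : ℂ → ℂ) (γ : ℝ) (z₀ : ℂ) (r : ℕ → ℝ) : Prop :=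
  ∃ θ : ℝ → ℝ, IsRayArg f z₀ θ ∧
    Tendsto (fun n => θ (r n) / Real.log ‖f (z₀ + r n) - f z₀‖) atTop (𝓝 γ)

/-- `f` stretches like `α` and rotates like `γ` at `z₀`, simultaneously along one sequence of
scales. -/
def StretchesAndRotatesLike (f : ℂ → ℂ) (α γ : ℝ) (z₀ : ℂ) : Prop :=
  ∃ r : ℕ → ℝ, IsScaleSeq r ∧ StretchesAlong f α z₀ r ∧ RotatesAlong f γ z₀ r

end QCMap

/-!
# Stretching and rotation on an uncountable set

Let `b = α (1 + i γ) - 1`. The radial map which equals `z ↦ z |z| ^ b` on an annulus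
`r ≤ |z| ≤ 1`, the identity outside the unit disc and a complex linear map inside radius `r` is
Lipschitz, and it has the distortion of the power map. Since it is linear near the origin, similar
copies of such maps can be planted in two smaller discs inside `|z| < r`, and the construction can
be repeated. At generation `m` the ratio is `r = scale m = exp (-(m + 1))` and the child discs have
radius `r / 4`. The resulting maps form a sequence `f 0, f 1, …`, where `f m` carries a copy of
`f (m + 1)` in each of its two child discs (`IsPlantedFamily`). In terms of the displacements
`f m z - z`, which vanish off the unit disc, planting is addition, so the sequence is the fixed
point of an affine contraction (`exists_isPlantedFamily`).

Every property of `f m` follows from one principle: a bounded quantity which is at most half of what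
it is one generation further vanishes (`forall_le_zero_of_contraction`). Applied to the distance of
two points with the same image it gives injectivity, applied to the distance to the image
surjectivity, applied to the area of the set where the differential is missing or has large
distortion it gives the distortion inequality almost everywhere, and applied to the failure of
integration by parts against a test function it shows that the classical derivative is the weak one.
In the last case boundedness comes from the area formula, which bounds the Dirichlet integral of an
injective map of bounded distortion. The distortion of the radial map is read off from the
hypothesis by uniqueness of weak derivatives. Orientation and the argument along a ray come from
lifting `f (z₀ + exp w) - f z₀` through the exponential.

The set `E` consists of the points lying in child discs of all generations (`cantorPoint`), one for
each sequence of binary choices. Along a horizontal ray towards such a point, the argument changes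
in one generation by `α γ log r` up to a bounded error: across the annulus the image stays close to
a logarithmic spiral, on the linear part it is a segment, and in the child it is a similar copy of
the next generation. The logarithms of `|f (z + t) - f z|` and of `t` change by `α log r` and
`log r`, again up to bounded errors. After `n` generations the errors are `O(n)`, while the sum of the
`log r` is of order `n ^ 2`, so the ratios converge to `α` and `γ`.
-/

open QCMap

/-! ### Continuous arguments -/

/-- A continuous function that avoids the zeros of a shifted cosine varies by less than `π`. -/
theorem abs_sub_lt_pi_of_cos_ne_zero {S : Set ℝ} (hS : IsPreconnected S) {θ : ℝ → ℝ}
    (hθ : ContinuousOn θ S) (a : ℝ) (h : ∀ t ∈ S, Real.cos (θ t - a) ≠ 0) {s t : ℝ}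
    (hs : s ∈ S) (ht : t ∈ S) : |θ s - θ t| < Real.pi := by
  wlog hle : θ s ≤ θ t generalizing s t
  · rw [abs_sub_comm]; exact this ht hs (le_of_not_ge hle)
  rw [abs_sub_comm, abs_of_nonneg (by linarith)]
  by_contra hcon
  push Not at hcon
  have hpi := Real.pi_pos
  set k : ℤ := ⌈(θ s - a) / Real.pi - 1 / 2⌉ with hk
  have h1 : (θ s - a) / Real.pi - 1 / 2 ≤ k := Int.le_ceil _
  have h2 : (k : ℝ) < (θ s - a) / Real.pi - 1 / 2 + 1 := Int.ceil_lt_add_one _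
  have e : (θ s - a) / Real.pi * Real.pi = θ s - a := by field_simp
  have h1' : θ s ≤ (k + 1 / 2) * Real.pi + a := by nlinarith
  have h2' : (k + 1 / 2) * Real.pi + a ≤ θ t := by nlinarith
  obtain ⟨x, hx, hxe⟩ := hS.intermediate_value hs ht hθ ⟨h1', h2'⟩
  apply h x hx
  rw [hxe, Real.cos_eq_zero_iff]
  exact ⟨k, by ring⟩

/-- A continuous function with values in `2πℤ` is constant. -/
theorem eq_of_forall_int_mul_two_pi {S : Set ℝ} (hS : IsPreconnected S) {θ : ℝ → ℝ}
    (hθ : ContinuousOn θ S) (h : ∀ t ∈ S, ∃ n : ℤ, θ t = n * (2 * Real.pi)) {s t : ℝ}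
    (hs : s ∈ S) (ht : t ∈ S) : θ s = θ t := by
  have := abs_sub_lt_pi_of_cos_ne_zero hS hθ 0 (by
    intro t ht
    obtain ⟨n, hn⟩ := h t ht
    rw [sub_zero, hn, Real.cos_int_mul_two_pi]; exact one_ne_zero) hs ht
  obtain ⟨n, hn⟩ := h s hs
  obtain ⟨m, hm⟩ := h t ht
  rw [hn, hm, ← sub_mul, abs_mul, abs_of_pos Real.two_pi_pos] at this
  have hlt : |((n - m : ℤ) : ℝ)| < 1 := by
    push_cast
    have := Real.pi_pos
    by_contra hc
    push Not at hc
    nlinarith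
  have : n - m = 0 := by
    rw [← Int.abs_lt_one_iff]; exact_mod_cast hlt
  rw [hn, hm, sub_eq_zero.1 this]

/-- Logarithmic polar coordinates about `z₀` and `f z₀`. -/
theorem exists_continuous_log_lift {f : ℂ → ℂ} (hf : Continuous f) (hinj : Function.Injective f)
    (z₀ : ℂ) : ∃ L : ℂ → ℂ, Continuous L ∧ ∀ w, Complex.exp (L w) = f (z₀ + Complex.exp w) - f z₀ := by
  have hne : ∀ w, f (z₀ + Complex.exp w) - f z₀ ≠ 0 := fun w h =>
    Complex.exp_ne_zero w (by simpa using hinj (sub_eq_zero.1 h))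
  obtain ⟨F, ⟨-, hF⟩, -⟩ := Complex.isCoveringMapOn_exp.existsUnique_continuousMap_lifts
    (f := (⟨fun w => f (z₀ + Complex.exp w) - f z₀, by fun_prop⟩ : C(ℂ, ℂ)))
    (a₀ := 0) (e₀ := Complex.log (f (z₀ + Complex.exp 0) - f z₀))
    (by simpa using Complex.exp_log (hne 0)) (by intro w; exact hne w)
  exact ⟨F, F.continuous, fun w => congrFun hF w⟩

theorem exists_int_of_exp_im {L M : ℂ} (h : Complex.exp L = Complex.exp M) :
    ∃ n : ℤ, L.im - M.im = n * (2 * Real.pi) := by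
  obtain ⟨n, hn⟩ := Complex.exp_eq_exp_iff_exists_int.1 h
  exact ⟨n, by rw [hn]; simp [mul_comm]⟩

theorem eq_norm_mul_exp_im {F L : ℂ} (h : Complex.exp L = F) :
    F = (‖F‖ : ℂ) * Complex.exp (L.im * Complex.I) := by
  rw [← h, Complex.norm_exp, Complex.ofReal_exp, ← Complex.exp_add, Complex.re_add_im]

/-- A continuous injection which is the identity near infinity has degree one on every circle:
the increment of the argument is continuous in the logarithm of the radius. -/
theorem orientationPreserving_of_eq_id {f : ℂ → ℂ} (hf : Continuous f)
    (hinj : Function.Injective f) (hid : ∀ z, 1 ≤ ‖z‖ → f z = z) : OrientationPreserving f := by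
  intro z₀ ρ hρ
  obtain ⟨L, hL, hLe⟩ := exists_continuous_log_lift hf hinj z₀
  refine ⟨fun t => (L (Real.log ρ + t * Complex.I)).im, by fun_prop, fun t => ?_, ?_⟩
  · have := hLe (Real.log ρ + t * Complex.I)
    rw [Complex.exp_add, ← Complex.ofReal_exp, Real.exp_log hρ] at this
    exact eq_norm_mul_exp_im this
  · have hint : ∀ s : ℝ, ∃ n : ℤ, (L (s + 2 * Real.pi * Complex.I)).im - (L s).im
        = n * (2 * Real.pi) := fun s => by
      apply exists_int_of_exp_im
      rw [hLe, hLe, Complex.exp_periodic]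
    have hconst := fun s t : ℝ => eq_of_forall_int_mul_two_pi (S := Set.univ) isPreconnected_univ
      (θ := fun s : ℝ => (L (s + 2 * Real.pi * Complex.I)).im - (L s).im)
      (by fun_prop) (fun s _ => hint s) (Set.mem_univ s) (Set.mem_univ t)
    -- on a circle this large `f` is the identity, and the circle encloses `f z₀`
    set s : ℝ := Real.log (‖z₀‖ + 1 + ‖z₀ - f z₀‖ + 1) with hs
    have hes : Real.exp s = ‖z₀‖ + 1 + ‖z₀ - f z₀‖ + 1 := Real.exp_log (by positivity)
    have hosc := abs_sub_lt_pi_of_cos_ne_zero (S := Set.univ) isPreconnected_univ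
      (θ := fun t : ℝ => (L (s + t * Complex.I)).im - t) (by fun_prop) 0 (by
        intro t _ h0
        have hn : ‖Complex.exp (s + t * Complex.I)‖ = Real.exp s := by
          rw [Complex.norm_exp]; simp
        have h1 : f (z₀ + Complex.exp (s + t * Complex.I)) = z₀ + Complex.exp (s + t * Complex.I) := by
          apply hid
          have := norm_sub_le (z₀ + Complex.exp (s + t * Complex.I)) z₀
          rw [add_sub_cancel_left, hn, hes] at this
          have := norm_nonneg (z₀ - f z₀)
          linarith
        have h2 : Complex.exp (L (s + t * Complex.I) - (s + t * Complex.I))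
            = 1 + (z₀ - f z₀) * Complex.exp (-(s + t * Complex.I)) := by
          rw [Complex.exp_sub, hLe, h1, Complex.exp_neg]
          field_simp [Complex.exp_ne_zero]
          ring
        have h3 : ‖(z₀ - f z₀) * Complex.exp (-(s + t * Complex.I))‖ < 1 := by
          rw [Complex.exp_neg, norm_mul, norm_inv, hn, ← div_eq_mul_inv, div_lt_one (Real.exp_pos _),
            hes]
          have := norm_nonneg z₀
          linarith
        have h4 := congrArg Complex.re h2
        rw [Complex.exp_re] at h4
        have h5 : (L (s + t * Complex.I) - (s + t * Complex.I)).im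
          = (L (s + t * Complex.I)).im - t := by simp
        rw [sub_zero] at h0
        rw [h5, h0, mul_zero, Complex.add_re, Complex.one_re] at h4
        have h6 := (abs_le.1 (Complex.abs_re_le_norm
          ((z₀ - f z₀) * Complex.exp (-(s + t * Complex.I))))).1
        linarith) (Set.mem_univ (2 * Real.pi)) (Set.mem_univ 0)
    obtain ⟨n, hn⟩ := hint s
    have hcs := hconst (Real.log ρ) s
    beta_reduce at hosc ⊢
    push_cast at hosc ⊢
    simp only [zero_mul, add_zero, sub_zero] at hosc ⊢
    rw [hcs, hn]
    have h7 : (L (s + 2 * Real.pi * Complex.I)).im - 2 * Real.pi - (L s).im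
      = (n - 1 : ℝ) * (2 * Real.pi) := by linear_combination hn
    rw [h7, abs_mul, abs_of_pos Real.two_pi_pos] at hosc
    have hlt : |((n - 1 : ℤ) : ℝ)| < 1 := by
      push_cast
      have := Real.pi_pos
      by_contra hc
      push Not at hc
      nlinarith
    have : n - 1 = 0 := by
      rw [← Int.abs_lt_one_iff]; exact_mod_cast hlt
    rw [sub_eq_zero.1 this]; simp

theorem tendsto_arg_add_atTop (a : ℂ) :
    Tendsto (fun r : ℝ => Complex.arg (a + r)) atTop (𝓝 0) := by
  have hlim : Tendsto (fun r : ℝ => Complex.arg (1 + (r⁻¹ : ℝ) * a)) atTop (𝓝 0) := by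
    have h1 : Tendsto (fun r : ℝ => 1 + ((r⁻¹ : ℝ) : ℂ) * a) atTop (𝓝 1) := by
      have := ((Complex.continuous_ofReal.tendsto 0).comp tendsto_inv_atTop_zero).mul_const a
      simpa using this.const_add 1
    have := (Complex.continuousAt_arg (x := 1) (by simp)).tendsto.comp h1
    rwa [Complex.arg_one] at this
  refine hlim.congr' ?_
  filter_upwards [eventually_gt_atTop 0] with r hr
  have : a + (r : ℂ) = r * (1 + (r⁻¹ : ℝ) * a) := by
    have : (r : ℂ) ≠ 0 := by exact_mod_cast hr.ne'
    push_cast; field_simp; ring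
  rw [this, Complex.arg_real_mul _ hr]

/-- The argument is the imaginary part of the logarithmic lift, up to a multiple of `2π`. -/
theorem exists_isRayArg {f : ℂ → ℂ} (hf : Continuous f)
    (hinj : Function.Injective f) (hid : ∀ z, 1 ≤ ‖z‖ → f z = z) (z₀ : ℂ) :
    ∃ θ, IsRayArg f z₀ θ := by
  obtain ⟨L, hL, hLe⟩ := exists_continuous_log_lift hf hinj z₀
  set a := z₀ - f z₀
  set R : ℝ := ‖z₀‖ + 1 + ‖a‖ + 1 with hR
  have hRpos : 0 < R := by positivity
  have key : ∀ r : ℝ, 0 < r → Complex.exp (L (Real.log r)) = f (z₀ + r) - f z₀ := fun r hr => by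
    rw [hLe, ← Complex.ofReal_exp, Real.exp_log hr]
  have hfar : ∀ r : ℝ, R ≤ r → f (z₀ + r) - f z₀ = r + a := fun r hr => by
    rw [hid]
    · simp only [a]; ring
    · have := norm_sub_le (z₀ + r) z₀
      rw [add_sub_cancel_left, Complex.norm_real, Real.norm_eq_abs] at this
      have := norm_nonneg a
      have := le_abs_self r
      linarith
  have hre : ∀ r : ℝ, R ≤ r → 0 < (r + a).re := fun r hr => by
    have := (abs_le.1 (Complex.abs_re_le_norm a)).1
    have := norm_nonneg z₀
    simp only [Complex.add_re, Complex.ofReal_re]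
    linarith
  have hcontL : ContinuousOn (fun r : ℝ => (L (Real.log r)).im) (Set.Ioi 0) := by
    refine Complex.continuous_im.comp_continuousOn (hL.comp_continuousOn
      (Complex.continuous_ofReal.comp_continuousOn ?_))
    exact Real.continuousOn_log.mono fun x hx => ne_of_gt hx
  have hint : ∀ r ∈ Set.Ici R, ∃ n : ℤ, (L (Real.log r)).im - Complex.arg (r + a)
      = n * (2 * Real.pi) := fun r hr => by
    have h0 : (r : ℂ) + a ≠ 0 := fun h => by
      have := hre r hr; rw [h] at this; simp at this
    have := exists_int_of_exp_im (L := L (Real.log r)) (M := Complex.log (r + a))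
      (by rw [key r (hRpos.trans_le hr), hfar r hr, Complex.exp_log h0])
    rwa [Complex.log_im] at this
  have hconst := fun r (hr : r ∈ Set.Ici R) =>
    eq_of_forall_int_mul_two_pi (S := Set.Ici R) isPreconnected_Ici
    (θ := fun r : ℝ => (L (Real.log r)).im - Complex.arg (r + a))
    ((hcontL.mono fun r hr => hRpos.trans_le hr).sub fun r hr =>
      (ContinuousAt.comp (f := fun r : ℝ => (r : ℂ) + a)
        (Complex.continuousAt_arg (Or.inl (hre r hr))) (by fun_prop)).continuousWithinAt)
    hint hr Set.self_mem_Ici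
  obtain ⟨n, hn⟩ := hint R Set.self_mem_Ici
  refine ⟨fun r => (L (Real.log r)).im - n * (2 * Real.pi), hcontL.sub continuousOn_const,
    fun r hr => ?_, ?_⟩
  · have := eq_norm_mul_exp_im (key r hr)
    push_cast
    rw [sub_mul, Complex.exp_sub, show (n : ℂ) * (2 * Real.pi) * Complex.I
      = n * (2 * Real.pi * Complex.I) by ring, Complex.exp_int_mul_two_pi_mul_I, div_one]
    exact this
  · refine (tendsto_arg_add_atTop a).congr' ?_
    filter_upwards [eventually_ge_atTop R] with r hr
    have h2 := hconst r hr
    simp only [hn] at h2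
    rw [add_comm]
    linarith

/-! ### Weak derivatives of Lipschitz maps -/

theorem QCMap.LocallyL2.locallyIntegrable {E : Type*} [NormedAddCommGroup E] {g : ℂ → E}
    (hg : LocallyL2 g) : LocallyIntegrable g volume := by
  rw [locallyIntegrable_iff]
  intro C hC
  have : IsFiniteMeasure (volume.restrict C) := ⟨by simpa using hC.measure_lt_top⟩
  exact (hg C hC).integrable one_le_two

theorem locallyIntegrable_clm_apply {D : ℂ → ℂ →L[ℝ] ℂ} (hD : LocallyIntegrable D volume) (v : ℂ) :
    LocallyIntegrable (fun z => D z v) volume := by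
  rw [locallyIntegrable_iff] at hD ⊢
  exact fun C hC => (hD C hC).apply_continuousLinearMap v

theorem integrable_fderiv_smul {φ : ℂ → ℝ} (hφ : ContDiff ℝ ∞ φ) (hc : HasCompactSupport φ)
    {f : ℂ → ℂ} (hf : LocallyIntegrable f volume) (v : ℂ) :
    Integrable (fun z => (fderiv ℝ φ z v) • f z) volume := by
  refine hf.integrable_smul_left_of_hasCompactSupport ?_ ?_
  · exact (hφ.continuous_fderiv (by simp)).clm_apply continuous_const
  · exact hc.fderiv_apply (𝕜 := ℝ) v

theorem integrable_smul_clm_apply {φ : ℂ → ℝ} (hφ : ContDiff ℝ ∞ φ) (hc : HasCompactSupport φ)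
    {D : ℂ → ℂ →L[ℝ] ℂ} (hD : LocallyIntegrable D volume) (v : ℂ) :
    Integrable (fun z => φ z • D z v) volume :=
  (locallyIntegrable_clm_apply hD v).integrable_smul_left_of_hasCompactSupport hφ.continuous hc

theorem LipschitzWith.locallyIntegrable_fderiv {C : NNReal} {f : ℂ → ℂ} (hf : LipschitzWith C f) :
    LocallyIntegrable (fderiv ℝ f) volume := by
  rw [locallyIntegrable_iff]
  intro S hS
  refine Measure.integrableOn_of_bounded (M := C) hS.measure_lt_top.ne
    (measurable_fderiv ℝ f).aestronglyMeasurable ?_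
  exact Eventually.of_forall fun z => norm_fderiv_le_of_lipschitz ℝ hf

/-- Integration by parts for Lipschitz maps, whose classical derivative exists almost everywhere
by Rademacher's theorem. -/
theorem LipschitzWith.isWeakDeriv {C : NNReal} {f : ℂ → ℂ} (hf : LipschitzWith C f) :
    IsWeakDeriv f (fderiv ℝ f) := by
  intro φ hφ hc v
  obtain ⟨D, hD⟩ := (hφ.of_le (m := 1) (by simp)).lipschitzWith_of_hasCompactSupport hc one_ne_zero
  have i1 := integrable_fderiv_smul hφ hc hf.continuous.locallyIntegrable v
  have i2 := integrable_smul_clm_apply hφ hc hf.locallyIntegrable_fderiv v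
  have key : ∀ (p : ℂ →L[ℝ] ℝ), p (∫ z, (fderiv ℝ φ z v) • f z) = p (- ∫ z, φ z • fderiv ℝ f z v) := by
    intro p
    have h := (p.lipschitz.comp hf).integral_lineDeriv_mul_eq (μ := volume) hD hc v
    rw [map_neg, ← p.integral_comp_comm i1, ← p.integral_comp_comm i2]
    have e1 : ∫ z, p (φ z • fderiv ℝ f z v) = ∫ z, lineDeriv ℝ (p ∘ f) z v * φ z := by
      refine integral_congr_ae ?_
      filter_upwards [hf.ae_differentiableAt] with z hz
      rw [map_smul, smul_eq_mul, mul_comm, (p.differentiableAt.comp z hz).lineDeriv_eq_fderiv,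
        fderiv_comp z p.differentiableAt hz]
      simp
    have e2 : ∫ z, lineDeriv ℝ φ z (-v) * (p ∘ f) z = - ∫ z, p ((fderiv ℝ φ z v) • f z) := by
      rw [← integral_neg]
      refine integral_congr_ae (Eventually.of_forall fun z => ?_)
      simp only [((hφ.differentiable (by simp)) z).lineDeriv_eq_fderiv, map_neg, map_smul,
        smul_eq_mul, Function.comp_apply, neg_mul]
    rw [e1, h, e2, neg_neg]
  exact Complex.ext (key Complex.reCLM) (key Complex.imCLM)

/-- Weak derivatives are local and unique. -/
theorem QCMap.IsWeakDeriv.ae_eq_of_eqOn {f g : ℂ → ℂ} {D D' : ℂ → ℂ →L[ℝ] ℂ} (hf : IsWeakDeriv f D)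
    (hg : IsWeakDeriv g D') (hD : LocallyIntegrable D volume) (hD' : LocallyIntegrable D' volume)
    {U : Set ℂ} (hU : IsOpen U) (hfg : Set.EqOn f g U) : ∀ᵐ z, z ∈ U → D z = D' z := by
  have key : ∀ v, ∀ᵐ z, z ∈ U → D z v - D' z v = 0 := fun v => by
    refine hU.ae_eq_zero_of_integral_contDiff_smul_eq_zero
      (((locallyIntegrable_clm_apply hD v).sub
        (locallyIntegrable_clm_apply hD' v)).locallyIntegrableOn U) ?_
    intro φ hφ hc hs
    have h1 := hf φ hφ hc v
    have h2 := hg φ hφ hc v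
    have h3 : ∫ z, (fderiv ℝ φ z v) • f z = ∫ z, (fderiv ℝ φ z v) • g z := by
      refine integral_congr_ae (Eventually.of_forall fun z => ?_)
      by_cases hz : z ∈ U
      · simp only [hfg hz]
      · have : fderiv ℝ φ z = 0 := by
          by_contra h
          exact hz (hs (support_fderiv_subset ℝ (by simpa using h)))
        simp [this]
    simp only [smul_sub]
    rw [integral_sub (integrable_smul_clm_apply hφ hc hD v) (integrable_smul_clm_apply hφ hc hD' v)]
    rw [h1, h2] at h3
    rw [neg_inj.1 h3, sub_self]
  filter_upwards [key 1, key Complex.I] with z h1 h2 hz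
  ext v
  have e : v = v.re • (1 : ℂ) + v.im • Complex.I := by
    conv_lhs => rw [← Complex.re_add_im v]
    simp
  rw [e, map_add, map_add, map_smul, map_smul, map_smul, map_smul, sub_eq_zero.1 (h1 hz),
    sub_eq_zero.1 (h2 hz)]

/-! ### Linear distortion and the Dirichlet integral -/

/-- The linear map `D` distorts the unit circle by a factor at most `K`. -/
def HasDistortion (K : ℝ) (D : ℂ →L[ℝ] ℂ) : Prop :=
  ∀ u v : ℂ, ‖u‖ = 1 → ‖v‖ = 1 → ‖D u‖ ≤ K * ‖D v‖

theorem det_eq_of_complex (D : ℂ →L[ℝ] ℂ) :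
    D.det = (D 1).re * (D Complex.I).im - (D Complex.I).re * (D 1).im := by
  rw [ContinuousLinearMap.det, ← LinearMap.det_toMatrix Complex.basisOneI, Matrix.det_fin_two]
  simp [LinearMap.toMatrix_apply]

theorem HasDistortion.homogeneous {K : ℝ} {D : ℂ →L[ℝ] ℂ} (h : HasDistortion K D) (u v : ℂ) :
    ‖v‖ * ‖D u‖ ≤ K * (‖u‖ * ‖D v‖) := by
  by_cases hu : u = 0
  · simp [hu]
  by_cases hv : v = 0
  · simp [hv]
  have hu' := norm_pos_iff.2 hu
  have hv' := norm_pos_iff.2 hv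
  have n : ∀ w : ℂ, w ≠ 0 → ‖(‖w‖⁻¹ : ℝ) • w‖ = 1 := fun w hw => by
    rw [norm_smul, norm_inv, norm_norm, inv_mul_cancel₀ (norm_ne_zero_iff.2 hw)]
  have := h _ _ (n u hu) (n v hv)
  simp only [map_smul, norm_smul, norm_inv, norm_norm] at this
  calc ‖v‖ * ‖D u‖ = ‖u‖ * ‖v‖ * (‖u‖⁻¹ * ‖D u‖) := by field_simp
    _ ≤ ‖u‖ * ‖v‖ * (K * (‖v‖⁻¹ * ‖D v‖)) := by gcongr
    _ = _ := by field_simp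

/-- The exponent `3` is not optimal, but avoids singular values: `‖D 1‖ ^ 2 ≤ K |det D|` by comparing
`D 1` with the component of `D I` orthogonal to it, and `‖D‖ ≤ K ‖D 1‖`. -/
theorem HasDistortion.norm_sq_le {K : ℝ} (hK : 0 ≤ K) {D : ℂ →L[ℝ] ℂ} (h : HasDistortion K D) :
    ‖D‖ ^ 2 ≤ K ^ 3 * |D.det| := by
  have h1 : ‖D‖ ≤ K * ‖D 1‖ := by
    refine D.opNorm_le_bound (by positivity) fun u => ?_
    have := h.homogeneous u 1
    rw [norm_one, one_mul] at this
    linarith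
  have h2 : ‖D 1‖ ^ 2 ≤ K * |D.det| := by
    by_cases h0 : D 1 = 0
    · rw [h0]; simp; positivity
    have hp := norm_pos_iff.2 h0
    -- `v` is chosen so that `D v` is the component of `D I` orthogonal to `D 1`
    set v : ℂ := ‖D 1‖ ^ 2 • Complex.I
      - ((D 1).re * (D Complex.I).re + (D 1).im * (D Complex.I).im) • (1 : ℂ) with hv
    have hn : ‖D 1‖ ^ 2 = (D 1).re ^ 2 + (D 1).im ^ 2 := by
      rw [Complex.sq_norm, Complex.normSq_apply]; ring
    have hDv : D v = D.det * (Complex.I * D 1) := by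
      rw [hv, map_sub, map_smul, map_smul, det_eq_of_complex, hn]
      apply Complex.ext <;> simp [pow_two] <;> ring
    have hvn : ‖D 1‖ ^ 2 ≤ ‖v‖ := by
      have := (abs_le.1 (Complex.abs_im_le_norm v)).2
      refine le_trans (le_of_eq ?_) this
      simp [hv, pow_two]
    have := h.homogeneous 1 v
    rw [hDv, norm_mul, norm_mul, Complex.norm_I, norm_one, Complex.norm_real, one_mul, one_mul,
      Real.norm_eq_abs] at this
    have h3 : ‖D 1‖ ^ 2 * ‖D 1‖ ≤ K * |D.det| * ‖D 1‖ := by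
      calc _ ≤ ‖v‖ * ‖D 1‖ := by gcongr
        _ ≤ _ := by rw [mul_assoc]; exact this
    exact le_of_mul_le_mul_right h3 hp
  calc ‖D‖ ^ 2 ≤ (K * ‖D 1‖) ^ 2 := by gcongr
    _ = K ^ 2 * ‖D 1‖ ^ 2 := by ring
    _ ≤ K ^ 2 * (K * |D.det|) := by gcongr
    _ = _ := by ring

/-- The Dirichlet integral is bounded by the integral of the Jacobian, which is the area of the
image. -/
theorem lintegral_norm_fderiv_sq_le {K : ℝ} (hK : 0 ≤ K) {f : ℂ → ℂ} (hinj : Function.Injective f)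
    (hd : ∀ᵐ z, DifferentiableAt ℝ f z ∧ HasDistortion K (fderiv ℝ f z)) {C : Set ℂ}
    (hC : MeasurableSet C) :
    ∫⁻ z in C, ‖fderiv ℝ f z‖ₑ ^ 2 ≤ ENNReal.ofReal (K ^ 3) * volume (f '' C) := by
  set S := C ∩ {z | DifferentiableAt ℝ f z} with hS
  have hSm : MeasurableSet S := hC.inter (measurableSet_of_differentiableAt ℝ f)
  have hSC : (S : Set ℂ) =ᵐ[volume] C := by
    filter_upwards [hd] with z hz
    have : (z ∈ S) = (z ∈ C) := by simp [hS, hz.1]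
    exact this
  calc ∫⁻ z in C, ‖fderiv ℝ f z‖ₑ ^ 2 = ∫⁻ z in S, ‖fderiv ℝ f z‖ₑ ^ 2 :=
        (setLIntegral_congr hSC).symm
    _ ≤ ∫⁻ z in S, ENNReal.ofReal (K ^ 3) * ENNReal.ofReal |(fderiv ℝ f z).det| := by
        refine lintegral_mono_ae (ae_restrict_of_ae ?_)
        filter_upwards [hd] with z hz
        rw [← ENNReal.ofReal_mul (by positivity), ← ofReal_norm,
          ← ENNReal.ofReal_pow (norm_nonneg _)]
        exact ENNReal.ofReal_le_ofReal (hz.2.norm_sq_le hK)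
    _ = ENNReal.ofReal (K ^ 3) * ∫⁻ z in S, ENNReal.ofReal |(fderiv ℝ f z).det| :=
        lintegral_const_mul' _ _ ENNReal.ofReal_ne_top
    _ = ENNReal.ofReal (K ^ 3) * volume (f '' S) := by
        rw [lintegral_abs_det_fderiv_eq_addHaar_image volume hSm
          (fun z hz => hz.2.hasFDerivAt.hasFDerivWithinAt) hinj.injOn]
    _ ≤ _ := by gcongr; exact Set.inter_subset_left

theorem locallyL2_of_continuous {f : ℂ → ℂ} (hf : Continuous f) : LocallyL2 f := fun C hC => by
  have : IsFiniteMeasure (volume.restrict C) := ⟨by simpa using hC.measure_lt_top⟩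
  obtain ⟨M, hM⟩ := hC.exists_bound_of_continuousOn hf.continuousOn
  exact MemLp.of_bound hf.aestronglyMeasurable M (ae_restrict_of_forall_mem hC.measurableSet hM)

/-- The area of the image controls the Dirichlet integral of an injective map of bounded
distortion. -/
theorem locallyL2_fderiv {K : ℝ} (hK : 0 ≤ K) {f : ℂ → ℂ} (hf : Continuous f)
    (hinj : Function.Injective f)
    (hd : ∀ᵐ z, DifferentiableAt ℝ f z ∧ HasDistortion K (fderiv ℝ f z)) :
    LocallyL2 (fderiv ℝ f) := by
  intro C hC
  refine ⟨(measurable_fderiv ℝ f).aestronglyMeasurable, ?_⟩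
  rw [eLpNorm_lt_top_iff_lintegral_rpow_enorm_lt_top two_ne_zero ENNReal.ofNat_ne_top]
  have := lintegral_norm_fderiv_sq_le hK hinj hd hC.measurableSet
  have hlt : ENNReal.ofReal (K ^ 3) * volume (f '' C) < ⊤ :=
    ENNReal.mul_lt_top ENNReal.ofReal_lt_top (hC.image hf).measure_lt_top
  refine lt_of_le_of_lt ?_ hlt
  simpa using this

/-! ### The radial map on an annulus -/

/-- The logarithm of `s` clamped to the interval `[r, 1]`. -/
noncomputable def logClamp (r s : ℝ) : ℝ := Real.log (max r (min s 1))

/-- The radial map which is `z ↦ z |z| ^ b` on the annulus `r ≤ |z| ≤ 1`, the identity outside the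
unit disc, and linear on the disc of radius `r`. -/
noncomputable def radialStretch (b : ℂ) (r : ℝ) (z : ℂ) : ℂ :=
  z * Complex.exp (b * logClamp r ‖z‖)

theorem logClamp_of_one_le {r s : ℝ} (hr : r ≤ 1) (hs : 1 ≤ s) : logClamp r s = 0 := by
  simp [logClamp, hs, hr]

theorem logClamp_of_le {r s : ℝ} (hr : r ≤ 1) (hs : s ≤ r) : logClamp r s = Real.log r := by
  rw [logClamp, min_eq_left (hs.trans hr), max_eq_left hs]

theorem logClamp_of_mem {r s : ℝ} (hs : r ≤ s) (hs1 : s ≤ 1) : logClamp r s = Real.log s := by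
  rw [logClamp, min_eq_left hs1, max_eq_right hs]

theorem continuous_logClamp {r : ℝ} (hr : 0 < r) : Continuous (logClamp r) := by
  unfold logClamp
  refine Continuous.log (by fun_prop) fun s => ?_
  exact (lt_max_of_lt_left hr).ne'

theorem logClamp_mono {r : ℝ} (hr : 0 < r) {s t : ℝ} (h : s ≤ t) : logClamp r s ≤ logClamp r t :=
  Real.log_le_log (lt_max_of_lt_left hr) (by gcongr)

theorem logClamp_sub_le {r : ℝ} (hr : 0 < r) {s t : ℝ} (hs : 0 < s) (h : s ≤ t) :
    logClamp r t - logClamp r s ≤ Real.log t - Real.log s := by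
  have ht := hs.trans_le h
  have hm : 0 < max r (min s 1) := lt_max_of_lt_left hr
  have hm' : 0 < max r (min t 1) := lt_max_of_lt_left hr
  unfold logClamp
  rw [← Real.log_div hm'.ne' hm.ne', ← Real.log_div ht.ne' hs.ne']
  refine Real.log_le_log (by positivity) ?_
  rw [div_le_div_iff₀ hm hs]
  rcases le_total r (min t 1) with h1 | h1
  · rw [max_eq_right h1]
    have : min t 1 * s ≤ t * min s 1 := by
      rcases le_total s 1 with h2 | h2
      · rw [min_eq_left h2]; exact mul_le_mul_of_nonneg_right (min_le_left _ _) hs.le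
      · rw [min_eq_right h2, min_eq_right (h2.trans h)]; linarith
    exact this.trans (mul_le_mul_of_nonneg_left (le_max_right _ _) ht.le)
  · rw [max_eq_left h1, mul_comm]
    exact mul_le_mul h (le_max_left _ _) hr.le ht.le

section radialStretch

variable {b : ℂ} {r : ℝ}

theorem radialStretch_of_one_le (hr : r ≤ 1) {z : ℂ} (hz : 1 ≤ ‖z‖) : radialStretch b r z = z := by
  rw [radialStretch, logClamp_of_one_le hr hz]; simp

theorem radialStretch_of_le (hr : r ≤ 1) {z : ℂ} (hz : ‖z‖ ≤ r) :
    radialStretch b r z = z * Complex.exp (b * Real.log r) := by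
  rw [radialStretch, logClamp_of_le hr hz]

theorem radialStretch_of_mem {z : ℂ} (hz : r ≤ ‖z‖) (hz1 : ‖z‖ ≤ 1) :
    radialStretch b r z = z * Complex.exp (b * Real.log ‖z‖) := by
  rw [radialStretch, logClamp_of_mem hz hz1]

theorem continuous_radialStretch (hr : 0 < r) : Continuous (radialStretch b r) := by
  have := (continuous_logClamp hr)
  unfold radialStretch
  fun_prop

theorem norm_radialStretch (z : ℂ) :
    ‖radialStretch b r z‖ = ‖z‖ * Real.exp (b.re * logClamp r ‖z‖) := by
  rw [radialStretch, norm_mul, Complex.norm_exp]; simp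

/-- On the logarithmic scale the radial profile has slope `1` or `1 + b.re`. -/
theorem radial_profile_strictMono (hr : 0 < r) (hb : -1 < b.re) {s t : ℝ} (hs : 0 ≤ s) (h : s < t) :
    s * Real.exp (b.re * logClamp r s) < t * Real.exp (b.re * logClamp r t) := by
  rcases hs.eq_or_lt with rfl | hs
  · rw [zero_mul]; positivity
  have ht := hs.trans h
  have h1 := logClamp_mono hr h.le
  have h2 := logClamp_sub_le hr hs h.le
  have h3 := Real.log_lt_log hs h
  have e : ∀ u : ℝ, 0 < u → u * Real.exp (b.re * logClamp r u)
      = Real.exp (Real.log u + b.re * logClamp r u) := fun u hu => by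
    rw [Real.exp_add, Real.exp_log hu]
  rw [e s hs, e t ht, Real.exp_lt_exp]
  rcases le_or_gt 0 b.re with hb0 | hb0
  · nlinarith
  · nlinarith

theorem norm_radialStretch_lt (hr : 0 < r) (hb : -1 < b.re) {z w : ℂ} (h : ‖z‖ < ‖w‖) :
    ‖radialStretch b r z‖ < ‖radialStretch b r w‖ := by
  rw [norm_radialStretch, norm_radialStretch]
  exact radial_profile_strictMono hr hb (norm_nonneg _) h

theorem norm_radialStretch_le_one (hr : 0 < r) (hr1 : r ≤ 1) (hb : -1 < b.re) {z : ℂ}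
    (h : ‖z‖ ≤ 1) : ‖radialStretch b r z‖ ≤ 1 := by
  rcases h.eq_or_lt with h | h
  · rw [radialStretch_of_one_le hr1 h.ge, h]
  · have := norm_radialStretch_lt (b := b) hr hb (z := z) (w := 1) (by simpa using h)
    rw [radialStretch_of_one_le hr1 (z := 1) (by simp)] at this
    simpa using this.le

theorem radialStretch_injective (hr : 0 < r) (hb : -1 < b.re) :
    Function.Injective (radialStretch b r) := by
  intro z w h
  have hn : ‖z‖ = ‖w‖ := by
    rcases lt_trichotomy ‖z‖ ‖w‖ with h1 | h1 | h1
    · exact absurd (congrArg norm h) (norm_radialStretch_lt hr hb h1).ne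
    · exact h1
    · exact absurd (congrArg norm h) (norm_radialStretch_lt hr hb h1).ne'
  unfold radialStretch at h
  rw [hn] at h
  exact mul_right_cancel₀ (Complex.exp_ne_zero _) h

/-- The modulus of the preimage is found by the intermediate value theorem. -/
theorem radialStretch_surjective (hr : 0 < r) (hr1 : r ≤ 1) :
    Function.Surjective (radialStretch b r) := by
  intro y
  obtain ⟨s, hs, hse⟩ : ∃ s ∈ Set.Icc 0 (‖y‖ + 1), s * Real.exp (b.re * logClamp r s) = ‖y‖ := by
    have hc : Continuous fun s => s * Real.exp (b.re * logClamp r s) := by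
      have := continuous_logClamp hr
      fun_prop
    refine intermediate_value_Icc (by positivity) hc.continuousOn ⟨by simp, ?_⟩
    rw [logClamp_of_one_le hr1 (by linarith [norm_nonneg y])]
    simp
  refine ⟨y * Complex.exp (-(b * logClamp r s)), ?_⟩
  have hn : ‖y * Complex.exp (-(b * logClamp r s))‖ = s := by
    rw [norm_mul, Complex.norm_exp, ← hse, mul_assoc, ← Real.exp_add]; simp
  rw [radialStretch, hn, mul_assoc, ← Complex.exp_add]; simp

theorem exists_lipschitzWith_radialStretch (b : ℂ) (hr : 0 < r) (hr1 : r ≤ 1) :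
    ∃ C, LipschitzWith C (radialStretch b r) := by
  have hcd : ContDiffOn ℝ 1 (fun x : ℝ => Complex.exp (b * Real.log x)) (Set.Icc r 1) := by
    have hlog : ContDiffOn ℝ 1 Real.log (Set.Icc r 1) :=
      Real.contDiffOn_log.mono fun x hx => (hr.trans_le hx.1).ne'
    exact (contDiffOn_const.mul (Complex.ofRealCLM.contDiff.comp_contDiffOn hlog)).cexp
  obtain ⟨C, hC⟩ := hcd.exists_lipschitzOnWith one_ne_zero (convex_Icc _ _) isCompact_Icc
  have hmem : ∀ s : ℝ, max r (min s 1) ∈ Set.Icc r 1 := fun s =>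
    ⟨le_max_left _ _, max_le hr1 (min_le_right _ _)⟩
  obtain ⟨M, hM⟩ := isCompact_Icc.exists_bound_of_continuousOn hcd.continuousOn
  set h : ℂ → ℂ := fun z => Complex.exp (b * logClamp r ‖z‖) with hh
  have hb : ∀ z, ‖h z‖ ≤ M := fun z => hM _ (hmem ‖z‖)
  have hM0 : 0 ≤ M := (norm_nonneg _).trans (hb 0)
  have hL : ∀ z w, ‖h z - h w‖ ≤ C * ‖z - w‖ := fun z w => by
    have h1 := hC.dist_le_mul _ (hmem ‖z‖) _ (hmem ‖w‖)
    rw [dist_eq_norm] at h1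
    refine h1.trans ?_
    gcongr
    rw [Real.dist_eq]
    calc |max r (min ‖z‖ 1) - max r (min ‖w‖ 1)| ≤ |min ‖z‖ 1 - min ‖w‖ 1| := by
          simpa using abs_max_sub_max_le_max r (min ‖z‖ 1) r (min ‖w‖ 1)
      _ ≤ |‖z‖ - ‖w‖| := by simpa using abs_min_sub_min_le_max ‖z‖ 1 ‖w‖ 1
      _ ≤ _ := abs_norm_sub_norm_le z w
  have key : ∀ z w, ‖w‖ ≤ 1 → ‖radialStretch b r z - radialStretch b r w‖ ≤ (M + C) * ‖z - w‖ := by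
    intro z w hw
    have e : radialStretch b r z - radialStretch b r w = (z - w) * h z + w * (h z - h w) := by
      simp only [radialStretch, hh]; ring
    rw [e]
    refine (norm_add_le _ _).trans ?_
    rw [norm_mul, norm_mul]
    calc _ ≤ ‖z - w‖ * M + 1 * (C * ‖z - w‖) := by
          gcongr
          · exact hb z
          · exact hL z w
      _ = _ := by ring
  refine ⟨⟨M + C + 1, by positivity⟩, LipschitzWith.of_dist_le_mul fun z w => ?_⟩
  rw [dist_eq_norm, dist_eq_norm]
  change _ ≤ (M + C + 1) * ‖z - w‖
  have hzw := norm_nonneg (z - w)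
  rcases le_total ‖w‖ 1 with hw | hw
  · nlinarith [key z w hw]
  rcases le_total ‖z‖ 1 with hz | hz
  · have := key w z hz
    rw [norm_sub_rev, norm_sub_rev w z] at this
    nlinarith
  · rw [radialStretch_of_one_le hr1 hw, radialStretch_of_one_le hr1 hz]
    nlinarith [C.2]

/-! ### Distortion of the radial map -/

theorem powerMap_eq {α γ : ℝ} {z : ℂ} (hz : z ≠ 0) :
    powerMap α γ z = z * Complex.exp ((α * (1 + Complex.I * γ) - 1) * Real.log ‖z‖) := by
  have : (‖z‖ : ℂ) ≠ 0 := by simpa using hz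
  rw [powerMap, Complex.cpow_def_of_ne_zero this, ← Complex.ofReal_log (norm_nonneg z), mul_comm
    (Real.log ‖z‖ : ℂ)]

theorem norm_powerMap {α γ : ℝ} {z : ℂ} (hz : z ≠ 0) : ‖powerMap α γ z‖ = ‖z‖ ^ α := by
  have hz' := norm_pos_iff.2 hz
  rw [powerMap_eq hz, norm_mul, Complex.norm_exp, Real.rpow_def_of_pos hz']
  conv_lhs => rw [← Real.exp_log hz']
  rw [← Real.exp_add]
  congr 1
  simp
  ring

/-- For `α ≤ 0` the power map is discontinuous at the origin. -/
theorem exponent_pos_of_continuous_powerMap {α γ : ℝ} (h : Continuous (powerMap α γ)) : 0 < α := by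
  by_contra hα
  push Not at hα
  have h0 : powerMap α γ 0 = 0 := by simp [powerMap]
  obtain ⟨δ, hδ, hd⟩ := Metric.continuousAt_iff.1 (h.continuousAt (x := 0)) 1 one_pos
  have hm : 0 < min (δ / 2) 1 := by positivity
  have hn : ‖((min (δ / 2) 1 : ℝ) : ℂ)‖ = min (δ / 2) 1 := by
    rw [Complex.norm_real, Real.norm_of_nonneg hm.le]
  have hne : ((min (δ / 2) 1 : ℝ) : ℂ) ≠ 0 := by exact_mod_cast hm.ne'
  have := hd (x := ((min (δ / 2) 1 : ℝ) : ℂ)) (by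
    rw [dist_zero_right, hn]; exact lt_of_le_of_lt (min_le_left _ _) (by linarith))
  rw [h0, dist_zero_right, norm_powerMap hne, hn] at this
  exact absurd this (not_lt.2 (Real.one_le_rpow_of_pos_of_le_one_of_nonpos hm (min_le_right _ _) hα))

/-- On the annulus the radial map is homogeneous of complex degree `1 + b`. -/
theorem fderiv_radialStretch_apply_self {z : ℂ} (hr : 0 < r) (hz : r < ‖z‖) (hz1 : ‖z‖ < 1)
    (hd : DifferentiableAt ℝ (radialStretch b r) z) :
    fderiv ℝ (radialStretch b r) z z = (1 + b) * radialStretch b r z := by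
  have hz0 : 0 < ‖z‖ := hr.trans hz
  have hpath : HasDerivAt (fun t : ℝ => Real.exp t • z) z 0 := by
    simpa using (Real.hasDerivAt_exp 0).smul_const z
  have h1 : HasDerivAt (fun t : ℝ => radialStretch b r (Real.exp t • z))
      (fderiv ℝ (radialStretch b r) z z) 0 := by
    have hd' : HasFDerivAt (radialStretch b r) (fderiv ℝ (radialStretch b r) z)
        (Real.exp 0 • z) := by simpa using hd.hasFDerivAt
    exact hd'.comp_hasDerivAt (0 : ℝ) hpath
  have h2 : HasDerivAt (fun t : ℝ => radialStretch b r z * Complex.exp ((1 + b) * (t : ℂ)))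
      ((1 + b) * radialStretch b r z) 0 := by
    have hl : HasDerivAt (fun t : ℝ => (1 + b) * (t : ℂ)) (1 + b) 0 := by
      simpa using (Complex.ofRealCLM.hasDerivAt (x := (0 : ℝ))).const_mul (1 + b)
    have := hl.cexp.const_mul (radialStretch b r z)
    simpa [mul_comm] using this
  have hev : (fun t : ℝ => radialStretch b r (Real.exp t • z)) =ᶠ[𝓝 0]
      fun t : ℝ => radialStretch b r z * Complex.exp ((1 + b) * (t : ℂ)) := by
    have hc : Tendsto (fun t : ℝ => ‖Real.exp t • z‖) (𝓝 0) (𝓝 ‖z‖) := by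
      have : Continuous fun t : ℝ => ‖Real.exp t • z‖ := by fun_prop
      simpa using this.tendsto 0
    filter_upwards [hc.eventually_const_lt hz, hc.eventually_lt_const hz1] with t ht ht1
    rw [radialStretch_of_mem ht.le ht1.le, radialStretch_of_mem hz.le hz1.le, norm_smul,
      Real.norm_of_nonneg (Real.exp_pos t).le, Real.log_mul (Real.exp_pos t).ne' hz0.ne',
      Real.log_exp, Complex.real_smul, Complex.ofReal_exp]
    push_cast
    rw [add_mul, one_mul, mul_add, Complex.exp_add, Complex.exp_add]
    ring
  exact h1.unique (h2.congr_of_eventuallyEq hev)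

theorem hasDistortion_smul_id {K : ℝ} (hK : 1 ≤ K) (c : ℂ) :
    HasDistortion K (c • ContinuousLinearMap.id ℝ ℂ) := by
  intro u v hu hv
  simp only [smul_apply, ContinuousLinearMap.id_apply, smul_eq_mul, norm_mul,
    hu, hv, mul_one]
  nlinarith [norm_nonneg c]

theorem ae_norm_ne (ρ : ℝ) : ∀ᵐ z : ℂ, ‖z‖ ≠ ρ := by
  refine measure_mono_null (fun z hz => ?_) (Measure.addHaar_sphere (volume : Measure ℂ) 0 ρ)
  simpa using hz

/-- The quasiconformality of the power map passes to its radial truncations; on the annulus, where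
the two maps agree, the classical derivative of the Lipschitz map `radialStretch` is identified
with the weak derivative of the power map. -/
theorem ae_hasDistortion_radialStretch {K α γ : ℝ} (hK : IsQuasiconformal K (powerMap α γ))
    (hr : 0 < r) (hr1 : r < 1) :
    1 ≤ K ∧ ∀ᵐ z, DifferentiableAt ℝ (radialStretch (α * (1 + Complex.I * γ) - 1) r) z ∧
      HasDistortion K (fderiv ℝ (radialStretch (α * (1 + Complex.I * γ) - 1) r) z) := by
  set b : ℂ := α * (1 + Complex.I * γ) - 1 with hb
  have hα := exponent_pos_of_continuous_powerMap hK.isHomeomorph.continuous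
  obtain ⟨C, hC⟩ := exists_lipschitzWith_radialStretch b hr hr1.le
  obtain ⟨D, hD, hdist⟩ := hK.distortion
  set U : Set ℂ := {z | r < ‖z‖ ∧ ‖z‖ < 1} with hU
  have hUo : IsOpen U :=
    (isOpen_lt continuous_const continuous_norm).inter (isOpen_lt continuous_norm continuous_const)
  have hDU := hD.weakDeriv.ae_eq_of_eqOn hC.isWeakDeriv hD.locallyL2_deriv.locallyIntegrable
    hC.locallyIntegrable_fderiv hUo (fun z hz => by
      rw [powerMap_eq (norm_pos_iff.1 (hr.trans hz.1)), radialStretch_of_mem hz.1.le hz.2.le])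
  have hae : ∀ᵐ z, z ∈ U → DifferentiableAt ℝ (radialStretch b r) z ∧
      HasDistortion K (fderiv ℝ (radialStretch b r) z) := by
    filter_upwards [hDU, hdist, hC.ae_differentiableAt] with z h1 h2 h3 hz
    refine ⟨h3, ?_⟩
    rw [← h1 hz]; exact h2
  have hK1 : 1 ≤ K := by
    have hUne : U.Nonempty := by
      refine ⟨(((r + 1) / 2 : ℝ) : ℂ), ?_⟩
      simp only [hU, Set.mem_ofPred_eq, Complex.norm_real]
      rw [Real.norm_of_nonneg (by linarith)]
      constructor <;> linarith
    obtain ⟨z, hzU, hz⟩ : ∃ z ∈ U, DifferentiableAt ℝ (radialStretch b r) z ∧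
        HasDistortion K (fderiv ℝ (radialStretch b r) z) := by
      by_contra hcon
      push Not at hcon
      have : volume U = 0 := by
        refine measure_mono_null (fun z hz => ?_) hae
        intro h
        exact hcon z hz (h hz).1 (h hz).2
      exact (hUo.measure_pos volume hUne).ne' this
    have h1 := fderiv_radialStretch_apply_self (b := b) hr hzU.1 hzU.2 hz.1
    have hz0 : 0 < ‖z‖ := hr.trans hzU.1
    have h2 : fderiv ℝ (radialStretch b r) z z ≠ 0 := by
      rw [h1, radialStretch, hb]
      refine mul_ne_zero ?_ (mul_ne_zero (norm_pos_iff.1 hz0) (Complex.exp_ne_zero _))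
      intro h
      have := congrArg Complex.re h
      simp at this
      exact hα.ne' this
    have h3 := hz.2.homogeneous z z
    have h4 : 0 < ‖z‖ * ‖fderiv ℝ (radialStretch b r) z z‖ := mul_pos hz0 (norm_pos_iff.2 h2)
    nlinarith
  refine ⟨hK1, ?_⟩
  filter_upwards [hae, ae_norm_ne r, ae_norm_ne 1] with z h1 h2 h3
  rcases lt_or_gt_of_ne h2 with hzr | hzr
  · have hev : radialStretch b r =ᶠ[𝓝 z]
        (Complex.exp (b * Real.log r) • ContinuousLinearMap.id ℝ ℂ : ℂ →L[ℝ] ℂ) := by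
      filter_upwards [continuous_norm.continuousAt.eventually_lt_const hzr] with w hw
      rw [radialStretch_of_le hr1.le hw.le]
      simp [mul_comm]
    have hf := (ContinuousLinearMap.hasFDerivAt _).congr_of_eventuallyEq hev
    refine ⟨hf.differentiableAt, ?_⟩
    rw [hf.fderiv]
    exact hasDistortion_smul_id hK1 _
  rcases lt_or_gt_of_ne h3 with hz1 | hz1
  · exact h1 ⟨hzr, hz1⟩
  · have hev : radialStretch b r =ᶠ[𝓝 z] ((1 : ℂ) • ContinuousLinearMap.id ℝ ℂ : ℂ →L[ℝ] ℂ) := by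
      filter_upwards [continuous_norm.continuousAt.eventually_const_lt hz1] with w hw
      rw [radialStretch_of_one_le hr1.le hw.le]
      simp
    have hf := (ContinuousLinearMap.hasFDerivAt _).congr_of_eventuallyEq hev
    refine ⟨hf.differentiableAt, ?_⟩
    rw [hf.fderiv]
    exact hasDistortion_smul_id hK1 _

end radialStretch

/-! ### Planting rescaled copies in child discs -/

/-- The ratio of the radii of the annulus used at generation `m`. -/
noncomputable def scale (m : ℕ) : ℝ := Real.exp (-(m + 1))

/-- The factor by which the radial map of generation `m` multiplies the disc of radius `scale m`. -/
noncomputable def multiplier (b : ℂ) (m : ℕ) : ℂ := Complex.exp (b * Real.log (scale m))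

/-- The centers of the two child discs. They lie on a vertical line, so that a horizontal ray from
a point of one child never meets the other. -/
noncomputable def childCenter (m : ℕ) (ε : Bool) : ℂ :=
  ((if ε then scale m / 2 else -(scale m / 2) : ℝ) : ℂ) * Complex.I

/-- The similarity carrying the child disc with center `childCenter m ε` and radius `scale m / 4`
to the unit disc. -/
noncomputable def childCoord (m : ℕ) (ε : Bool) (z : ℂ) : ℂ :=
  (z - childCenter m ε) / (scale m / 4 : ℝ)

/-- A family of maps in which `f m` is the radial map of generation `m` with a rescaled copy of
`f (m + 1)` planted in each child disc. The displacement `f m z - z` vanishes off the unit disc, so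
planting amounts to adding displacements. -/
structure IsPlantedFamily (b : ℂ) (f : ℕ → ℂ → ℂ) : Prop where
  continuous : ∀ m, Continuous (f m)
  bounded : ∃ B, ∀ m z, ‖f m z - z‖ ≤ B
  eq : ∀ m z, f m z = radialStretch b (scale m) z + multiplier b m * (scale m / 4 : ℝ) *
    ((f (m + 1) (childCoord m true z) - childCoord m true z) +
      (f (m + 1) (childCoord m false z) - childCoord m false z))

theorem scale_pos (m : ℕ) : 0 < scale m := Real.exp_pos _

theorem scale_lt_half (m : ℕ) : scale m < 1 / 2 := by
  have h1 : scale m ≤ Real.exp (-1) := Real.exp_le_exp.2 (by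
    have : (0 : ℝ) ≤ m := m.cast_nonneg
    linarith)
  have h2 : Real.exp (-1) < 1 / 2 := by
    rw [Real.exp_neg, inv_lt_comm₀ (Real.exp_pos _) (by norm_num)]
    have := Real.exp_one_gt_d9
    linarith
  exact h1.trans_lt h2

theorem log_scale (m : ℕ) : Real.log (scale m) = -(m + 1) := Real.log_exp _

theorem scale_le_one (m : ℕ) : scale m ≤ 1 := by linarith [scale_lt_half m]

theorem norm_multiplier (b : ℂ) (m : ℕ) :
    ‖multiplier b m‖ = Real.exp (b.re * Real.log (scale m)) := by
  rw [multiplier, Complex.norm_exp]; simp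

theorem norm_multiplier_mul_scale (b : ℂ) (m : ℕ) :
    ‖multiplier b m‖ * scale m = Real.exp ((b.re + 1) * Real.log (scale m)) := by
  rw [norm_multiplier, add_mul, Real.exp_add, one_mul, Real.exp_log (scale_pos m)]

theorem norm_multiplier_mul_scale_le {b : ℂ} (hb : -1 < b.re) (m : ℕ) :
    ‖multiplier b m‖ * scale m ≤ 1 := by
  rw [norm_multiplier_mul_scale]
  refine Real.exp_le_one_iff.2 (mul_nonpos_of_nonneg_of_nonpos (by linarith) ?_)
  exact Real.log_nonpos (scale_pos m).le (scale_le_one m)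

theorem multiplier_ne_zero (b : ℂ) (m : ℕ) : multiplier b m ≠ 0 := Complex.exp_ne_zero _

theorem norm_childCenter (m : ℕ) (ε : Bool) : ‖childCenter m ε‖ = scale m / 2 := by
  have := scale_pos m
  rw [childCenter, norm_mul, Complex.norm_I, mul_one, Complex.norm_real, Real.norm_eq_abs]
  cases ε <;> simp <;> positivity

theorem continuous_childCoord (m : ℕ) (ε : Bool) : Continuous (childCoord m ε) := by
  unfold childCoord; fun_prop

theorem eq_childCenter_add (m : ℕ) (ε : Bool) (z : ℂ) :
    z = childCenter m ε + (scale m / 4 : ℝ) * childCoord m ε z := by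
  have : ((scale m / 4 : ℝ) : ℂ) ≠ 0 := by
    have := scale_pos m
    exact_mod_cast (by positivity : scale m / 4 ≠ 0)
  rw [childCoord]; field_simp; ring

theorem childCoord_childCenter_add (m : ℕ) (ε : Bool) (w : ℂ) :
    childCoord m ε (childCenter m ε + (scale m / 4 : ℝ) * w) = w := by
  have : ((scale m / 4 : ℝ) : ℂ) ≠ 0 := by
    have := scale_pos m
    exact_mod_cast (by positivity : scale m / 4 ≠ 0)
  rw [childCoord]; field_simp; ring

theorem norm_childCenter_add_le (m : ℕ) (ε : Bool) {w : ℂ} (hw : ‖w‖ ≤ 1) :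
    ‖childCenter m ε + (scale m / 4 : ℝ) * w‖ ≤ 3 / 4 * scale m := by
  have := scale_pos m
  refine (norm_add_le _ _).trans ?_
  rw [norm_childCenter, norm_mul, Complex.norm_real, Real.norm_of_nonneg (by positivity)]
  nlinarith

theorem norm_le_of_childCoord {m : ℕ} {ε : Bool} {z : ℂ} (h : ‖childCoord m ε z‖ ≤ 1) :
    ‖z‖ ≤ 3 / 4 * scale m := by
  rw [eq_childCenter_add m ε z]; exact norm_childCenter_add_le m ε h

theorem one_lt_norm_childCoord {m : ℕ} {z : ℂ} (h : 3 / 4 * scale m < ‖z‖) (ε : Bool) :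
    1 < ‖childCoord m ε z‖ := by
  by_contra hc
  exact absurd (norm_le_of_childCoord (not_lt.1 hc)) (not_le.2 h)

/-- The two child discs are disjoint. -/
theorem one_lt_norm_childCoord_not {m : ℕ} {ε : Bool} {z : ℂ} (h : ‖childCoord m ε z‖ ≤ 1) :
    1 < ‖childCoord m (!ε) z‖ := by
  have hs : (scale m : ℂ) ≠ 0 := by exact_mod_cast (scale_pos m).ne'
  have h4 : ‖childCoord m (!ε) z - childCoord m ε z‖ = 4 := by
    have : childCoord m (!ε) z - childCoord m ε z = (if ε then 4 else -4 : ℂ) * Complex.I := by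
      cases ε <;> simp [childCoord, childCenter] <;> field_simp <;> ring
    rw [this]; cases ε <;> simp
  have := norm_sub_le (childCoord m (!ε) z) (childCoord m ε z)
  linarith

/-- If every common upper bound of `u` can be halved, then `u` is nonpositive. -/
theorem forall_le_zero_of_contraction {ι : Sort*} {u : ι → ℝ} {C₀ : ℝ} (hC₀ : 0 ≤ C₀)
    (h0 : ∀ i, u i ≤ C₀) (hc : ∀ C, 0 ≤ C → (∀ i, u i ≤ C) → ∀ i, u i ≤ C / 2) (i : ι) :
    u i ≤ 0 := by
  have key : ∀ n : ℕ, ∀ i, u i ≤ C₀ * (1 / 2) ^ n := by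
    intro n
    induction n with
    | zero => simpa using h0
    | succ n ih =>
      intro i
      have := hc _ (by positivity) ih i
      rw [pow_succ]; linarith
  have hl : Tendsto (fun n : ℕ => C₀ * (1 / 2 : ℝ) ^ n) atTop (𝓝 (C₀ * 0)) :=
    (tendsto_pow_atTop_nhds_zero_of_lt_one (by norm_num) (by norm_num)).const_mul _
  rw [mul_zero] at hl
  exact ge_of_tendsto' hl fun n => key n i

/-- The displacements are the fixed point of an affine contraction of the space of bounded continuous
functions on `ℕ × ℂ`. -/
theorem exists_isPlantedFamily {b : ℂ} (hb : -1 < b.re) : ∃ f, IsPlantedFamily b f := by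
  have hRb : ∀ p : ℕ × ℂ, ‖radialStretch b (scale p.1) p.2 - p.2‖ ≤ 2 := by
    rintro ⟨m, z⟩
    rcases le_total ‖z‖ 1 with hz | hz
    · have := norm_radialStretch_le_one (scale_pos m) (scale_le_one m) hb hz
      exact (norm_sub_le _ _).trans (by simp only; linarith)
    · simp [radialStretch_of_one_le (scale_le_one m) hz]
  -- `ℕ` is discrete, so continuity is checked on each generation
  have hco : ∀ {F : ℕ × ℂ → ℂ}, (∀ m, Continuous fun z => F (m, z)) → Continuous F :=
    fun h => continuous_prod_of_discrete_left.2 h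
  set A : BoundedContinuousFunction (ℕ × ℂ) ℂ := BoundedContinuousFunction.ofNormedAddCommGroup
    (fun p : ℕ × ℂ => radialStretch b (scale p.1) p.2 - p.2)
    (hco fun m => (continuous_radialStretch (scale_pos m)).sub continuous_id) 2 hRb with hA
  set q : ℕ → ℂ := fun m => multiplier b m * (scale m / 4 : ℝ) with hq
  have hqn : ∀ m, ‖q m‖ ≤ 1 / 4 := fun m => by
    have := norm_multiplier_mul_scale_le hb m
    have := scale_pos m
    rw [hq]
    simp only [norm_mul, Complex.norm_real]
    rw [Real.norm_of_nonneg (by positivity)]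
    linarith
  have hsum : ∀ (G : ℕ × ℂ → ℂ) (C : ℝ), (∀ p, ‖G p‖ ≤ C) → ∀ p : ℕ × ℂ,
      ‖q p.1 * (G (p.1 + 1, childCoord p.1 true p.2) + G (p.1 + 1, childCoord p.1 false p.2))‖
        ≤ C / 2 := fun G C hG p => by
    rw [norm_mul]
    have h1 := (norm_add_le _ _).trans (add_le_add (hG (p.1 + 1, childCoord p.1 true p.2))
      (hG (p.1 + 1, childCoord p.1 false p.2)))
    calc _ ≤ 1 / 4 * (C + C) := mul_le_mul (hqn _) h1 (norm_nonneg _) (by norm_num)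
      _ = C / 2 := by ring
  have hcont : ∀ G : BoundedContinuousFunction (ℕ × ℂ) ℂ, Continuous fun p : ℕ × ℂ =>
      q p.1 * (G (p.1 + 1, childCoord p.1 true p.2) + G (p.1 + 1, childCoord p.1 false p.2)) :=
    fun G => hco fun m => by
      have hG : ∀ ε, Continuous fun z => G (m + 1, childCoord m ε z) := fun ε =>
        G.continuous.comp (continuous_const.prodMk (continuous_childCoord m ε))
      exact (continuous_const (y := q m)).fun_mul ((hG true).fun_add (hG false))
  set T : BoundedContinuousFunction (ℕ × ℂ) ℂ → BoundedContinuousFunction (ℕ × ℂ) ℂ := fun G =>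
    A + BoundedContinuousFunction.ofNormedAddCommGroup _ (hcont G) (‖G‖ / 2)
      (hsum G ‖G‖ G.norm_coe_le_norm) with hT
  have hTc : ContractingWith (1 / 2) T := by
    refine ⟨by norm_num, LipschitzWith.of_dist_le_mul fun G H => ?_⟩
    rw [BoundedContinuousFunction.dist_le (by positivity)]
    intro p
    have := hsum (fun p => G p - H p) (dist G H) (fun p => by
      rw [← dist_eq_norm]; exact BoundedContinuousFunction.dist_coe_le_dist p) p
    rw [dist_eq_norm]
    have e : T G p - T H p = q p.1 * ((G (p.1 + 1, childCoord p.1 true p.2)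
        - H (p.1 + 1, childCoord p.1 true p.2)) + (G (p.1 + 1, childCoord p.1 false p.2)
        - H (p.1 + 1, childCoord p.1 false p.2))) := by
      simp [hT]; ring
    rw [e]
    refine this.trans (le_of_eq ?_)
    simp; ring
  set G := ContractingWith.fixedPoint T hTc with hG
  have hfix : T G = G := hTc.fixedPoint_isFixedPt
  refine ⟨fun m z => z + G (m, z), fun m => by have := G.continuous; fun_prop, ⟨‖G‖, fun m z => by
    simpa using G.norm_coe_le_norm (m, z)⟩, fun m z => ?_⟩
  have := congrArg (fun H : BoundedContinuousFunction (ℕ × ℂ) ℂ => H (m, z)) hfix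
  simp only [hT, hA, BoundedContinuousFunction.add_apply,
    BoundedContinuousFunction.coe_ofNormedAddCommGroup] at this
  simp only [← this]
  ring

/-! ### The maps of a planted family are homeomorphisms -/

namespace IsPlantedFamily

variable {b : ℂ} {f : ℕ → ℂ → ℂ}

/-- Points off the unit disc lie off both children in all generations. -/
theorem eq_id (h : IsPlantedFamily b f) (hb : -1 < b.re) {m : ℕ} {z : ℂ} (hz : 1 ≤ ‖z‖) :
    f m z = z := by
  obtain ⟨B, hB⟩ := h.bounded
  have key := forall_le_zero_of_contraction (ι := {p : ℕ × ℂ // 1 ≤ ‖p.2‖})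
    (u := fun p => ‖f p.1.1 p.1.2 - p.1.2‖) (C₀ := B) ((norm_nonneg _).trans (hB 0 0))
    (fun p => hB _ _) (by
      rintro C hC hu ⟨⟨m, z⟩, hz⟩
      have hs := scale_pos m
      have hs2 := scale_lt_half m
      simp only at hz ⊢
      have hz' : 3 / 4 * scale m < ‖z‖ := by linarith
      have h1 := hu ⟨(m + 1, childCoord m true z), (one_lt_norm_childCoord hz' true).le⟩
      have h2 := hu ⟨(m + 1, childCoord m false z), (one_lt_norm_childCoord hz' false).le⟩
      simp only at h1 h2
      rw [h.eq, radialStretch_of_one_le (scale_le_one m) hz, add_sub_cancel_left, norm_mul, norm_mul,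
        Complex.norm_real, Real.norm_of_nonneg (by positivity)]
      have h3 := norm_multiplier_mul_scale_le hb m
      have h4 := (norm_add_le _ _).trans (add_le_add h1 h2)
      calc _ ≤ 1 / 4 * (C + C) := by
            refine mul_le_mul ?_ h4 (norm_nonneg _) (by norm_num)
            linarith
        _ = C / 2 := by ring) ⟨(m, z), hz⟩
  exact sub_eq_zero.1 (norm_le_zero_iff.1 key)

theorem eq_radialStretch (h : IsPlantedFamily b f) (hb : -1 < b.re) {m : ℕ} {z : ℂ}
    (hz : ∀ ε, 1 ≤ ‖childCoord m ε z‖) : f m z = radialStretch b (scale m) z := by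
  rw [h.eq, h.eq_id hb (hz true), h.eq_id hb (hz false)]; simp

/-- On a child disc `f m` is conjugate to `f (m + 1)` up to the linear factor `multiplier b m`. -/
theorem eq_child (h : IsPlantedFamily b f) (hb : -1 < b.re) {m : ℕ} {z : ℂ} {ε : Bool}
    (hz : ‖childCoord m ε z‖ ≤ 1) : f m z = multiplier b m *
      (childCenter m ε + (scale m / 4 : ℝ) * f (m + 1) (childCoord m ε z)) := by
  have h1 := h.eq_id hb (m := m + 1) (one_lt_norm_childCoord_not hz).le
  have h2 := norm_le_of_childCoord hz
  have h3 := scale_pos m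
  have h4 : f m z = radialStretch b (scale m) z + multiplier b m * (scale m / 4 : ℝ) *
      (f (m + 1) (childCoord m ε z) - childCoord m ε z) := by
    rw [h.eq]
    cases ε
    · rw [show f (m + 1) (childCoord m true z) = childCoord m true z from h1]; simp
    · rw [show f (m + 1) (childCoord m false z) = childCoord m false z from h1]; simp
  rw [h4, radialStretch_of_le (scale_le_one m) (by linarith), ← multiplier]
  conv_lhs => rw [eq_childCenter_add m ε z]
  rw [childCoord_childCenter_add]
  ring

theorem norm_le_one (h : IsPlantedFamily b f) (hb : -1 < b.re) {m : ℕ} {z : ℂ} (hz : ‖z‖ ≤ 1) :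
    ‖f m z‖ ≤ 1 := by
  obtain ⟨B, hB⟩ := h.bounded
  have key := forall_le_zero_of_contraction (ι := {p : ℕ × ℂ // ‖p.2‖ ≤ 1})
    (u := fun p => ‖f p.1.1 p.1.2‖ - 1) (C₀ := B) ((norm_nonneg _).trans (hB 0 0))
    (by
      rintro ⟨⟨m, z⟩, hz⟩
      have := hB m z
      have h1 := norm_sub_norm_le (f m z) z
      simp only at hz ⊢
      linarith) (by
      rintro C hC hu ⟨⟨m, z⟩, hz⟩
      simp only at hz ⊢
      have hs := scale_pos m
      by_cases hε : ∃ ε, ‖childCoord m ε z‖ ≤ 1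
      · obtain ⟨ε, hε⟩ := hε
        have h1 := hu ⟨(m + 1, childCoord m ε z), hε⟩
        simp only at h1
        have h3 := norm_multiplier_mul_scale_le hb m
        rw [h.eq_child hb hε, norm_mul]
        have h4 : ‖childCenter m ε + (scale m / 4 : ℝ) * f (m + 1) (childCoord m ε z)‖
            ≤ scale m * (3 / 4 + C / 4) := by
          refine (norm_add_le _ _).trans ?_
          rw [norm_childCenter, norm_mul, Complex.norm_real, Real.norm_of_nonneg (by positivity)]
          nlinarith
        calc _ ≤ ‖multiplier b m‖ * (scale m * (3 / 4 + C / 4)) - 1 := by gcongr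
          _ = (‖multiplier b m‖ * scale m) * (3 / 4 + C / 4) - 1 := by ring
          _ ≤ 1 * (3 / 4 + C / 4) - 1 := by gcongr
          _ ≤ C / 2 := by linarith
      · push Not at hε
        rw [h.eq_radialStretch hb fun ε => (hε ε).le]
        have := norm_radialStretch_le_one (scale_pos m) (scale_le_one m) hb hz
        linarith) ⟨(m, z), hz⟩
  simp only at key
  linarith

/-- `f m` is the radial map precomposed with a map that moves points only inside the children. -/
theorem exists_eq_radialStretch (h : IsPlantedFamily b f) (hb : -1 < b.re) (m : ℕ) (z : ℂ) :
    ∃ p, f m z = radialStretch b (scale m) p ∧ ((p = z ∧ ∀ ε, 1 < ‖childCoord m ε z‖) ∨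
      ∃ ε, ‖childCoord m ε z‖ ≤ 1 ∧ ‖childCoord m ε p‖ ≤ 1 ∧
        childCoord m ε p = f (m + 1) (childCoord m ε z)) := by
  by_cases hε : ∃ ε, ‖childCoord m ε z‖ ≤ 1
  · obtain ⟨ε, hε⟩ := hε
    have h1 := h.norm_le_one hb (m := m + 1) hε
    have h2 := norm_childCenter_add_le m ε h1
    have hs := scale_pos m
    refine ⟨childCenter m ε + (scale m / 4 : ℝ) * f (m + 1) (childCoord m ε z), ?_,
      Or.inr ⟨ε, hε, ?_, ?_⟩⟩
    · rw [h.eq_child hb hε, radialStretch_of_le (scale_le_one m) (by linarith), ← multiplier, mul_comm]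
    · rwa [childCoord_childCenter_add]
    · rw [childCoord_childCenter_add]
  · push Not at hε
    exact ⟨z, h.eq_radialStretch hb fun ε => (hε ε).le, Or.inl ⟨rfl, hε⟩⟩

/-- Two points with the same image lie in the same child, where their coordinates again have the
same image but a larger distance. -/
theorem injective (h : IsPlantedFamily b f) (hb : -1 < b.re) (m : ℕ) :
    Function.Injective (f m) := by
  intro z w hzw
  obtain ⟨B, hB⟩ := h.bounded
  have key := forall_le_zero_of_contraction
    (ι := {p : ℕ × ℂ × ℂ // f p.1 p.2.1 = f p.1 p.2.2})
    (u := fun p => ‖p.1.2.1 - p.1.2.2‖) (C₀ := B + B)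
    (add_nonneg ((norm_nonneg _).trans (hB 0 0)) ((norm_nonneg _).trans (hB 0 0)))
    (by
      rintro ⟨⟨m, z, w⟩, hzw⟩
      simp only at hzw ⊢
      have e : z - w = (f m w - w) - (f m z - z) := by rw [hzw]; ring
      rw [e]
      exact (norm_sub_le _ _).trans (add_le_add (hB _ _) (hB _ _))) (by
      rintro C hC hu ⟨⟨m, z, w⟩, hzw⟩
      simp only at hzw ⊢
      have hs := scale_pos m
      have hs2 := scale_lt_half m
      obtain ⟨p, hp, hp'⟩ := h.exists_eq_radialStretch hb m z
      obtain ⟨q, hq, hq'⟩ := h.exists_eq_radialStretch hb m w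
      have hpq : p = q := radialStretch_injective hs hb (by rw [← hp, ← hq, hzw])
      subst hpq
      rcases hp' with ⟨rfl, hz⟩ | ⟨ε, hz1, hz2, hz3⟩
      · rcases hq' with ⟨rfl, -⟩ | ⟨ε, hw1, hw2, hw3⟩
        · simp; positivity
        · exact absurd (hz ε) (not_lt.2 hw2)
      · rcases hq' with ⟨rfl, hw⟩ | ⟨δ, hw1, hw2, hw3⟩
        · exact absurd (hw ε) (not_lt.2 hz2)
        · have hδ : δ = ε := by
            by_contra hne
            have : δ = !ε := by cases δ <;> cases ε <;> simp_all
            rw [this] at hw2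
            exact absurd (one_lt_norm_childCoord_not hz2) (not_lt.2 hw2)
          subst hδ
          have := hu ⟨(m + 1, childCoord m δ z, childCoord m δ w), by simp only; rw [← hz3, ← hw3]⟩
          simp only at this
          have e : z - w = (scale m / 4 : ℝ) * (childCoord m δ z - childCoord m δ w) := by
            conv_lhs => rw [eq_childCenter_add m δ z, eq_childCenter_add m δ w]
            ring
          rw [e, norm_mul, Complex.norm_real, Real.norm_of_nonneg (by positivity)]
          nlinarith) ⟨(m, z, w), hzw⟩
  exact sub_eq_zero.1 (norm_le_zero_iff.1 key)

/-- The distance to the compact image of the unit disc contracts from one generation to the next. -/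
theorem surjective (h : IsPlantedFamily b f) (hb : -1 < b.re) (m : ℕ) :
    Function.Surjective (f m) := by
  intro y
  rcases le_total 1 ‖y‖ with hy | hy
  · exact ⟨y, h.eq_id hb hy⟩
  have hcomp : ∀ m, IsCompact (f m '' Metric.closedBall 0 1) := fun m =>
    (isCompact_closedBall _ _).image (h.continuous m)
  have hne : ∀ m, (f m '' Metric.closedBall 0 1).Nonempty := fun m =>
    (Metric.nonempty_closedBall.2 zero_le_one).image _
  have key := forall_le_zero_of_contraction (ι := {p : ℕ × ℂ // ‖p.2‖ ≤ 1})
    (u := fun p => Metric.infDist p.1.2 (f p.1.1 '' Metric.closedBall 0 1)) (C₀ := 2) zero_le_two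
    (by
      rintro ⟨⟨m, y⟩, hy⟩
      refine (Metric.infDist_le_dist_of_mem (Set.mem_image_of_mem (f m)
        (Metric.mem_closedBall_self zero_le_one))).trans ?_
      have := h.norm_le_one hb (m := m) (z := 0) (by simp)
      rw [dist_eq_norm]
      refine (norm_sub_le _ _).trans ?_
      simp only at hy ⊢
      linarith) (by
      rintro C hC hu ⟨⟨m, y⟩, hy⟩
      simp only at hy ⊢
      have hs := scale_pos m
      obtain ⟨p, rfl⟩ := radialStretch_surjective (b := b) hs (scale_le_one m) y
      have hp : ‖p‖ ≤ 1 := by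
        by_contra hc
        rw [radialStretch_of_one_le (scale_le_one m) (not_le.1 hc).le] at hy
        exact hc hy
      by_cases hε : ∃ ε, ‖childCoord m ε p‖ ≤ 1
      · obtain ⟨ε, hε⟩ := hε
        have h1 := hu ⟨(m + 1, childCoord m ε p), hε⟩
        simp only at h1
        obtain ⟨_, ⟨x, hx, rfl⟩, hxd⟩ := (hcomp (m + 1)).exists_infDist_eq_dist (hne (m + 1))
          (childCoord m ε p)
        rw [hxd, dist_eq_norm] at h1
        rw [mem_closedBall_zero_iff] at hx
        have hx2 := norm_childCenter_add_le m ε hx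
        have hp2 := norm_le_of_childCoord hε
        refine (Metric.infDist_le_dist_of_mem (Set.mem_image_of_mem (f m)
          (x := childCenter m ε + (scale m / 4 : ℝ) * x) ?_)).trans ?_
        · rw [mem_closedBall_zero_iff]; linarith [scale_le_one m]
        · rw [dist_eq_norm, h.eq_child hb (ε := ε) (by rwa [childCoord_childCenter_add]),
            childCoord_childCenter_add, radialStretch_of_le (scale_le_one m) (by linarith),
            ← multiplier]
          have e : p * multiplier b m - multiplier b m * (childCenter m ε + (scale m / 4 : ℝ) *
              f (m + 1) x) = multiplier b m * ((scale m / 4 : ℝ) *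
                (childCoord m ε p - f (m + 1) x)) := by
            conv_lhs => rw [eq_childCenter_add m ε p]
            ring
          rw [e, norm_mul, norm_mul, Complex.norm_real, Real.norm_of_nonneg (by positivity)]
          have h3 := norm_multiplier_mul_scale_le hb m
          calc _ = (‖multiplier b m‖ * scale m) * (‖childCoord m ε p - f (m + 1) x‖ / 4) := by ring
            _ ≤ 1 * (C / 4) := by gcongr
            _ ≤ C / 2 := by linarith
      · push Not at hε
        have hmem : radialStretch b (scale m) p ∈ f m '' Metric.closedBall 0 1 :=
          ⟨p, by rwa [mem_closedBall_zero_iff], h.eq_radialStretch hb fun ε => (hε ε).le⟩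
        rw [Metric.infDist_zero_of_mem hmem]
        positivity) ⟨(m, y), hy⟩
  obtain ⟨x, -, hx⟩ := ((hcomp m).isClosed.mem_iff_infDist_zero (hne m)).2
    (le_antisymm key Metric.infDist_nonneg)
  exact ⟨x, hx⟩

/-- A continuous bijection which is the identity near infinity is proper. -/
theorem isHomeomorph (h : IsPlantedFamily b f) (hb : -1 < b.re) (m : ℕ) : IsHomeomorph (f m) := by
  rw [isHomeomorph_iff_continuous_isClosedMap_bijective]
  refine ⟨h.continuous m, ?_, h.injective hb m, h.surjective hb m⟩
  refine (isProperMap_iff_tendsto_cocompact.2 ⟨h.continuous m, ?_⟩).isClosedMap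
  refine tendsto_id.congr' ?_
  filter_upwards [(isCompact_closedBall (0 : ℂ) 1).compl_mem_cocompact] with z hz
  rw [Set.mem_compl_iff, mem_closedBall_zero_iff, not_le] at hz
  rw [id, h.eq_id hb hz.le]

theorem isPrincipal (h : IsPlantedFamily b f) (hb : -1 < b.re) (m : ℕ) : IsPrincipal (f m) := by
  refine Asymptotics.IsBigO.of_bound 1 ?_
  filter_upwards [tendsto_norm_cobounded_atTop.eventually_ge_atTop 1] with z hz
  rw [h.eq_id hb hz]; simp

end IsPlantedFamily

/-! ### Integration by parts and rescaling -/

theorem childCoord_eq_smul (m : ℕ) (ε : Bool) :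
    childCoord m ε = fun z => (scale m / 4)⁻¹ • (z - childCenter m ε) := by
  ext z
  rw [childCoord, Complex.real_smul, div_eq_inv_mul, Complex.ofReal_inv]

theorem hasFDerivAt_childCoord (m : ℕ) (ε : Bool) (z : ℂ) :
    HasFDerivAt (childCoord m ε) ((scale m / 4)⁻¹ • ContinuousLinearMap.id ℝ ℂ) z := by
  rw [childCoord_eq_smul]
  exact ((hasFDerivAt_id (𝕜 := ℝ) z).sub_const (childCenter m ε)).const_smul (scale m / 4)⁻¹

theorem volume_preimage_childCoord (m : ℕ) (ε : Bool) (S : Set ℂ) :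
    volume (childCoord m ε ⁻¹' S) = ENNReal.ofReal ((scale m / 4) ^ 2) * volume S := by
  have hs := scale_pos m
  rw [childCoord_eq_smul]
  have : (fun z => (scale m / 4)⁻¹ • (z - childCenter m ε)) ⁻¹' S
      = (fun z => z - childCenter m ε) ⁻¹' ((fun z => (scale m / 4)⁻¹ • z) ⁻¹' S) := rfl
  rw [this]
  simp_rw [sub_eq_add_neg]
  rw [measure_preimage_add_right, Measure.addHaar_preimage_smul volume (by positivity),
    Complex.finrank_real_complex, inv_pow, inv_inv, abs_of_nonneg (by positivity)]

theorem integral_comp_childCoord (m : ℕ) (ε : Bool) (H : ℂ → ℂ) :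
    ∫ z, H (childCoord m ε z) = ((scale m / 4 : ℝ) : ℂ) ^ 2 * ∫ z, H z := by
  have hs := scale_pos m
  rw [childCoord_eq_smul]
  rw [integral_sub_right_eq_self (fun z => H ((scale m / 4)⁻¹ • z)) (childCenter m ε),
    Measure.integral_comp_smul, Complex.finrank_real_complex, inv_pow, inv_inv,
    abs_of_nonneg (by positivity), Complex.real_smul, Complex.ofReal_pow]

theorem integrable_comp_childCoord (m : ℕ) (ε : Bool) {H : ℂ → ℂ} (hH : Integrable H volume) :
    Integrable (fun z => H (childCoord m ε z)) volume := by
  have hs := scale_pos m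
  rw [childCoord_eq_smul]
  exact (hH.comp_smul (R := (scale m / 4)⁻¹) (by positivity)).comp_sub_right _

theorem ae_comp_childCoord (m : ℕ) (ε : Bool) {P : ℂ → Prop} (hP : ∀ᵐ z, P z) :
    ∀ᵐ z, P (childCoord m ε z) := by
  have := volume_preimage_childCoord m ε {z | ¬ P z}
  rw [show volume {z | ¬ P z} = 0 from hP, mul_zero] at this
  exact this

theorem HasDistortion.smul {K : ℝ} {D : ℂ →L[ℝ] ℂ} (h : HasDistortion K D) (c : ℂ) :
    HasDistortion K (c • D) := fun u v hu hv => by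
  simp only [smul_apply, norm_smul]
  have := mul_le_mul_of_nonneg_left (h u v hu hv) (norm_nonneg c)
  linarith

/-- The failure of integration by parts for the pair `(f, D)` against the test function `φ` in the
direction `v`. -/
noncomputable def weakDefect (f : ℂ → ℂ) (D : ℂ → ℂ →L[ℝ] ℂ) (φ : ℂ → ℝ) (v : ℂ) : ℂ :=
  ∫ z, (fderiv ℝ φ z v) • f z + φ z • D z v

/-- A test function seen from a child disc. -/
noncomputable def childTest (m : ℕ) (ε : Bool) (φ : ℂ → ℝ) (w : ℂ) : ℝ :=
  φ (childCenter m ε + (scale m / 4) • w)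

theorem childTest_childCoord (m : ℕ) (ε : Bool) (φ : ℂ → ℝ) (z : ℂ) :
    childTest m ε φ (childCoord m ε z) = φ z := by
  rw [childTest, Complex.real_smul, ← eq_childCenter_add]

theorem fderiv_childTest (m : ℕ) (ε : Bool) {φ : ℂ → ℝ} (hφ : ContDiff ℝ ∞ φ) (w v : ℂ) :
    fderiv ℝ (childTest m ε φ) w v
      = scale m / 4 * fderiv ℝ φ (childCenter m ε + (scale m / 4) • w) v := by
  have h1 : HasFDerivAt (fun w : ℂ => childCenter m ε + (scale m / 4) • w)
      ((scale m / 4) • ContinuousLinearMap.id ℝ ℂ) w :=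
    ((hasFDerivAt_id w).const_smul (scale m / 4)).const_add _
  have h2 := ((hφ.differentiable (by simp)) (childCenter m ε + (scale m / 4) • w)).hasFDerivAt.comp w h1
  have h3 : fderiv ℝ (childTest m ε φ) w = _ := h2.fderiv
  rw [h3]
  simp

theorem contDiff_childTest (m : ℕ) (ε : Bool) {φ : ℂ → ℝ} (hφ : ContDiff ℝ ∞ φ) :
    ContDiff ℝ ∞ (childTest m ε φ) :=
  hφ.comp (contDiff_const.add (contDiff_id.const_smul _))

theorem hasCompactSupport_childTest (m : ℕ) (ε : Bool) {φ : ℂ → ℝ} (hc : HasCompactSupport φ) :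
    HasCompactSupport (childTest m ε φ) := by
  have hs := scale_pos m
  exact hc.comp_homeomorph ((Homeomorph.smulOfNeZero (scale m / 4) (by positivity)).trans
    (Homeomorph.addLeft (childCenter m ε)))

/-- Rescaling a pair to a child disc amounts to rescaling the test function. -/
theorem weakDefect_comp_childCoord (m : ℕ) (ε : Bool) (f : ℂ → ℂ) (D : ℂ → ℂ →L[ℝ] ℂ) {φ : ℂ → ℝ}
    (hφ : ContDiff ℝ ∞ φ) (v : ℂ) :
    weakDefect (fun z => f (childCoord m ε z)) (fun z => (scale m / 4)⁻¹ • D (childCoord m ε z)) φ v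
      = (scale m / 4 : ℝ) * weakDefect f D (childTest m ε φ) v := by
  have hs := scale_pos m
  have hs' : ((scale m / 4 : ℝ) : ℂ) ≠ 0 := by exact_mod_cast (by positivity : scale m / 4 ≠ 0)
  set H : ℂ → ℂ := fun w => ((scale m / 4 : ℝ) : ℂ)⁻¹ *
    ((fderiv ℝ (childTest m ε φ) w v) • f w + childTest m ε φ w • D w v) with hH
  have e : ∀ z, (fderiv ℝ φ z v) • f (childCoord m ε z)
      + φ z • ((scale m / 4)⁻¹ • D (childCoord m ε z)) v = H (childCoord m ε z) := fun z => by
    simp only [hH, childTest_childCoord, fderiv_childTest m ε hφ, Complex.real_smul,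
      smul_apply, ← eq_childCenter_add, Complex.ofReal_mul, Complex.ofReal_inv]
    field_simp
  refine (integral_congr_ae (Eventually.of_forall e)).trans
    ((integral_comp_childCoord m ε H).trans ?_)
  rw [integral_const_mul, weakDefect]
  field_simp

theorem QCMap.IsWeakDeriv.weakDefect_eq_zero {f : ℂ → ℂ} {D : ℂ → ℂ →L[ℝ] ℂ} (h : IsWeakDeriv f D)
    (hf : LocallyIntegrable f volume) (hD : LocallyIntegrable D volume) {φ : ℂ → ℝ}
    (hφ : ContDiff ℝ ∞ φ) (hc : HasCompactSupport φ) (v : ℂ) : weakDefect f D φ v = 0 := by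
  rw [weakDefect, integral_add (integrable_fderiv_smul hφ hc hf v)
    (integrable_smul_clm_apply hφ hc hD v), h φ hφ hc v, neg_add_cancel]

/-- The vector field by which `g` moves points. -/
def displacement (g : ℂ → ℂ) (z : ℂ) : ℂ := g z - z

/-- The classical derivative of the displacement of `g`. -/
noncomputable def displacementDeriv (g : ℂ → ℂ) (z : ℂ) : ℂ →L[ℝ] ℂ :=
  fderiv ℝ g z - ContinuousLinearMap.id ℝ ℂ

theorem continuous_displacement {g : ℂ → ℂ} (hg : Continuous g) : Continuous (displacement g) :=
  hg.sub continuous_id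

theorem locallyIntegrable_displacementDeriv {g : ℂ → ℂ}
    (hD : LocallyIntegrable (fderiv ℝ g) volume) :
    LocallyIntegrable (displacementDeriv g) volume :=
  hD.sub (continuous_const (y := ContinuousLinearMap.id ℝ ℂ)).locallyIntegrable

/-- The identity contributes no defect. -/
theorem weakDefect_displacement {g : ℂ → ℂ} (hg : Continuous g)
    (hD : LocallyIntegrable (fderiv ℝ g) volume) {φ : ℂ → ℝ}
    (hφ : ContDiff ℝ ∞ φ) (hc : HasCompactSupport φ) (v : ℂ) :
    weakDefect (displacement g) (displacementDeriv g) φ v = weakDefect g (fderiv ℝ g) φ v := by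
  set I : ℂ →L[ℝ] ℂ := ContinuousLinearMap.id ℝ ℂ with hI
  have hIi : LocallyIntegrable (fun _ : ℂ => I) volume := continuous_const.locallyIntegrable
  have hid : IsWeakDeriv (fun z => z) (fun _ => I) := by
    have := (LipschitzWith.id (α := ℂ)).isWeakDeriv
    have e : fderiv ℝ (id : ℂ → ℂ) = fun _ => I := by ext1 z; exact fderiv_id
    rw [e] at this
    exact this
  have hzero := hid.weakDefect_eq_zero continuous_id.locallyIntegrable hIi hφ hc v
  have j1 : Integrable (fun z => (fderiv ℝ φ z v) • g z + φ z • fderiv ℝ g z v) volume :=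
    (integrable_fderiv_smul hφ hc hg.locallyIntegrable v).add
      (integrable_smul_clm_apply hφ hc hD v)
  have j2 : Integrable (fun z => (fderiv ℝ φ z v) • z + φ z • I v) volume :=
    (integrable_fderiv_smul hφ hc (f := fun z => z) continuous_id.locallyIntegrable v).add
      (integrable_smul_clm_apply hφ hc hIi v)
  have e : ∀ z, (fderiv ℝ φ z v) • displacement g z + φ z • displacementDeriv g z v
      = ((fderiv ℝ φ z v) • g z + φ z • fderiv ℝ g z v)
        - ((fderiv ℝ φ z v) • z + φ z • I v) := fun z => by
    simp only [displacement, displacementDeriv, sub_apply, smul_sub, hI]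
    abel
  refine (integral_congr_ae (Eventually.of_forall e)).trans ((integral_sub j1 j2).trans ?_)
  exact (congrArg (_ - ·) hzero).trans (sub_zero _)

theorem integrable_displacement_comp_childCoord {g : ℂ → ℂ} (hg : Continuous g)
    (hD : LocallyIntegrable (fderiv ℝ g) volume) (m : ℕ) (ε : Bool) {φ : ℂ → ℝ}
    (hφ : ContDiff ℝ ∞ φ) (hc : HasCompactSupport φ) (v : ℂ) :
    Integrable (fun z => (fderiv ℝ φ z v) • displacement g (childCoord m ε z)
      + φ z • ((scale m / 4)⁻¹ • displacementDeriv g (childCoord m ε z)) v) volume := by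
  have h1 := integrable_comp_childCoord m ε (integrable_smul_clm_apply
    (contDiff_childTest m ε hφ) (hasCompactSupport_childTest m ε hc)
    (locallyIntegrable_displacementDeriv hD) v)
  have h2 : LocallyIntegrable (fun z => displacement g (childCoord m ε z)) volume :=
    ((continuous_displacement hg).comp (continuous_childCoord m ε)).locallyIntegrable
  refine (integrable_fderiv_smul hφ hc h2 v).add ?_
  have e : ∀ z, φ z • ((scale m / 4)⁻¹ • displacementDeriv g (childCoord m ε z)) v
    = ((scale m / 4)⁻¹ : ℝ) • (childTest m ε φ (childCoord m ε z) •
      displacementDeriv g (childCoord m ε z) v) := fun z => by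
    rw [childTest_childCoord, smul_apply, smul_comm]
  simp only [e]
  exact h1.fun_smul _

/-! ### Quasiconformality of planted families -/

namespace IsPlantedFamily

variable {b : ℂ} {f : ℕ → ℂ → ℂ}

theorem hasFDerivAt_of_child (h : IsPlantedFamily b f) (hb : -1 < b.re) {m : ℕ} {z : ℂ} {ε : Bool}
    (hz : ‖childCoord m ε z‖ < 1) {D : ℂ →L[ℝ] ℂ}
    (hD : HasFDerivAt (f (m + 1)) D (childCoord m ε z)) :
    HasFDerivAt (f m) (multiplier b m • D) z := by
  have hs := scale_pos m
  have hev : f m =ᶠ[𝓝 z] fun w => multiplier b m *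
      (childCenter m ε + (scale m / 4) • f (m + 1) (childCoord m ε w)) := by
    filter_upwards [(continuous_childCoord m ε).norm.continuousAt.eventually_lt_const hz] with w hw
    rw [h.eq_child hb hw.le, Complex.real_smul]
  have h1 := (((hD.comp z (hasFDerivAt_childCoord m ε z)).const_smul (scale m / 4)).const_add
    (childCenter m ε)).const_smul (multiplier b m)
  refine (h1.congr_of_eventuallyEq hev).congr_fderiv ?_
  ext v
  simp only [smul_apply, ContinuousLinearMap.comp_apply, ContinuousLinearMap.id_apply, map_smul]
  rw [smul_smul (scale m / 4), mul_inv_cancel₀ (by positivity), one_smul]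

theorem eventuallyEq_radialStretch (h : IsPlantedFamily b f) (hb : -1 < b.re) {m : ℕ} {z : ℂ}
    (hz : ∀ ε, 1 < ‖childCoord m ε z‖) : f m =ᶠ[𝓝 z] radialStretch b (scale m) := by
  filter_upwards [(continuous_childCoord m true).norm.continuousAt.eventually_const_lt (hz true),
    (continuous_childCoord m false).norm.continuousAt.eventually_const_lt (hz false)] with w h1 h2
  refine h.eq_radialStretch hb fun ε => ?_
  cases ε
  · exact h2.le
  · exact h1.le

/-- The set of bad points is, up to a null set, covered by its own copies in the children, whose
total area is smaller by a definite factor. -/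
theorem ae_hasDistortion (h : IsPlantedFamily b f) (hb : -1 < b.re) {K : ℝ} (hK : 1 ≤ K)
    (hR : ∀ m, ∀ᵐ z, DifferentiableAt ℝ (radialStretch b (scale m)) z ∧
      HasDistortion K (fderiv ℝ (radialStretch b (scale m)) z)) (m : ℕ) :
    ∀ᵐ z, DifferentiableAt ℝ (f m) z ∧ HasDistortion K (fderiv ℝ (f m) z) := by
  set P : ℕ → ℂ → Prop := fun m z => DifferentiableAt ℝ (f m) z ∧ HasDistortion K (fderiv ℝ (f m) z)
    with hP
  set B : ℕ → Set ℂ := fun m => {z | ¬ P m z ∧ ‖z‖ ≤ 1} with hB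
  have hBfin : ∀ m, volume (B m) ≤ volume (Metric.closedBall (0 : ℂ) 1) := fun m =>
    measure_mono fun z hz => by simpa using hz.2
  have hfin : volume (Metric.closedBall (0 : ℂ) 1) ≠ ⊤ := measure_closedBall_lt_top.ne
  have hBtop : ∀ m, volume (B m) ≠ ⊤ := fun m => ne_top_of_le_ne_top hfin (hBfin m)
  have hcov : ∀ m, volume (B m) ≤ volume (childCoord m true ⁻¹' B (m + 1))
      + volume (childCoord m false ⁻¹' B (m + 1)) := fun m => by
    refine le_trans (measure_mono_ae ?_) (measure_union_le _ _)
    filter_upwards [hR m, ae_comp_childCoord m true (ae_norm_ne 1),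
      ae_comp_childCoord m false (ae_norm_ne 1)] with z h1 h2 h3 hz
    have key : ∀ ε, ‖childCoord m ε z‖ < 1 → z ∈ childCoord m ε ⁻¹' B (m + 1) := by
      intro ε hε
      refine ⟨fun hp => hz.1 ?_, hε.le⟩
      have hd := h.hasFDerivAt_of_child hb hε hp.1.hasFDerivAt
      refine ⟨hd.differentiableAt, ?_⟩
      rw [hd.fderiv]
      exact hp.2.smul _
    rcases lt_or_gt_of_ne h2 with h2 | h2
    · exact Or.inl (key _ h2)
    rcases lt_or_gt_of_ne h3 with h3 | h3
    · exact Or.inr (key _ h3)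
    · exfalso
      have hev := h.eventuallyEq_radialStretch hb (m := m) (z := z) (fun ε => by
        cases ε
        · exact h3
        · exact h2)
      refine hz.1 ⟨hev.differentiableAt_iff.2 h1.1, ?_⟩
      rw [hev.fderiv_eq]
      exact h1.2
  have key := forall_le_zero_of_contraction (u := fun m => (volume (B m)).toReal)
    (C₀ := (volume (Metric.closedBall (0 : ℂ) 1)).toReal) ENNReal.toReal_nonneg
    (fun m => ENNReal.toReal_mono hfin (hBfin m)) (by
      intro C hC hu m
      have hs := scale_pos m
      have hs2 := scale_lt_half m
      have h1 := hcov m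
      rw [volume_preimage_childCoord, volume_preimage_childCoord] at h1
      have h2 := ENNReal.toReal_mono (ENNReal.add_ne_top.2
        ⟨ENNReal.mul_ne_top ENNReal.ofReal_ne_top (hBtop (m + 1)),
          ENNReal.mul_ne_top ENNReal.ofReal_ne_top (hBtop (m + 1))⟩) h1
      rw [ENNReal.toReal_add (ENNReal.mul_ne_top ENNReal.ofReal_ne_top (hBtop (m + 1)))
        (ENNReal.mul_ne_top ENNReal.ofReal_ne_top (hBtop (m + 1))), ENNReal.toReal_mul,
        ENNReal.toReal_ofReal (by positivity)] at h2
      have h3 := hu (m + 1)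
      have h4 : (scale m / 4) ^ 2 ≤ 1 / 4 := by nlinarith
      refine h2.trans ?_
      have h5 := mul_le_mul h4 h3 ENNReal.toReal_nonneg (by norm_num)
      linarith) m
  have hBz : volume (B m) = 0 := by
    have := le_antisymm key ENNReal.toReal_nonneg
    exact ((ENNReal.toReal_eq_zero_iff _).1 this).resolve_right (hBtop m)
  have hBz' : ∀ᵐ z, z ∉ B m := measure_eq_zero_iff_ae_notMem.1 hBz
  filter_upwards [hBz'] with z hz
  by_cases hz1 : ‖z‖ ≤ 1
  · by_contra hn
    exact hz ⟨hn, hz1⟩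
  · have hev : f m =ᶠ[𝓝 z] ((1 : ℂ) • ContinuousLinearMap.id ℝ ℂ : ℂ →L[ℝ] ℂ) := by
      filter_upwards [continuous_norm.continuousAt.eventually_const_lt (not_le.1 hz1)] with w hw
      rw [h.eq_id hb hw.le]; simp
    have hf := (ContinuousLinearMap.hasFDerivAt _).congr_of_eventuallyEq hev
    refine ⟨hf.differentiableAt, ?_⟩
    rw [hf.fderiv]
    exact hasDistortion_smul_id hK _

/-- The displacements satisfy a linear recursion, and so do their derivatives. -/
theorem displacementDeriv_eq (h : IsPlantedFamily b f) {m : ℕ} {z : ℂ}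
    (hR : DifferentiableAt ℝ (radialStretch b (scale m)) z)
    (hd : ∀ ε, DifferentiableAt ℝ (f (m + 1)) (childCoord m ε z)) :
    displacementDeriv (f m) z = displacementDeriv (radialStretch b (scale m)) z
      + (multiplier b m • displacementDeriv (f (m + 1)) (childCoord m true z)
        + multiplier b m • displacementDeriv (f (m + 1)) (childCoord m false z)) := by
  have hs := scale_pos m
  set a : ℂ := multiplier b m * (scale m / 4 : ℝ) with ha
  have hc : ∀ ε, HasFDerivAt (fun z => a • (f (m + 1) (childCoord m ε z) - childCoord m ε z))
      (multiplier b m • displacementDeriv (f (m + 1)) (childCoord m ε z)) z := fun ε => by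
    have := ((((hd ε).hasFDerivAt.sub (hasFDerivAt_id _)).comp z
      (hasFDerivAt_childCoord m ε z))).const_smul a
    refine this.congr_fderiv ?_
    ext w
    have hs' : ((scale m / 4 : ℝ) : ℂ) ≠ 0 := by exact_mod_cast (by positivity : scale m / 4 ≠ 0)
    simp only [smul_apply, ContinuousLinearMap.comp_apply, sub_apply, ContinuousLinearMap.id_apply,
      map_smul, displacementDeriv]
    simp only [Complex.real_smul, smul_eq_mul, ha, Complex.ofReal_inv]
    field_simp
  have hfd : HasFDerivAt (f m) (fderiv ℝ (radialStretch b (scale m)) z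
      + (multiplier b m • displacementDeriv (f (m + 1)) (childCoord m true z)
        + multiplier b m • displacementDeriv (f (m + 1)) (childCoord m false z))) z := by
    have hff : f m = fun z => radialStretch b (scale m) z
        + (a • (f (m + 1) (childCoord m true z) - childCoord m true z)
          + a • (f (m + 1) (childCoord m false z) - childCoord m false z)) := by
      ext z
      rw [h.eq]; simp only [smul_eq_mul, ha]; ring
    rw [hff]
    exact hR.hasFDerivAt.add ((hc true).add (hc false))
  have e : displacementDeriv (radialStretch b (scale m)) z
    = fderiv ℝ (radialStretch b (scale m)) z - ContinuousLinearMap.id ℝ ℂ := rfl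
  rw [displacementDeriv, hfd.fderiv, e]
  abel

/-- The defect of integration by parts on one scale is a combination of the defects on the next,
because the radial map, being Lipschitz, contributes none. -/
theorem weakDefect_displacement_eq (h : IsPlantedFamily b f)
    (hL : ∀ m, LocallyIntegrable (fderiv ℝ (f m)) volume)
    (hd : ∀ m, ∀ᵐ z, DifferentiableAt ℝ (f m) z) (m : ℕ) {φ : ℂ → ℝ}
    (hφ : ContDiff ℝ ∞ φ) (hc : HasCompactSupport φ) (v : ℂ) :
    weakDefect (displacement (f m)) (displacementDeriv (f m)) φ v =
      multiplier b m * (scale m / 4 : ℝ) * ((scale m / 4 : ℝ) *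
        weakDefect (displacement (f (m + 1))) (displacementDeriv (f (m + 1))) (childTest m true φ) v)
      + multiplier b m * (scale m / 4 : ℝ) * ((scale m / 4 : ℝ) *
        weakDefect (displacement (f (m + 1))) (displacementDeriv (f (m + 1)))
          (childTest m false φ) v) := by
  have hs := scale_pos m
  have hs' : ((scale m / 4 : ℝ) : ℂ) ≠ 0 := by exact_mod_cast (by positivity : scale m / 4 ≠ 0)
  obtain ⟨L, hLip⟩ := exists_lipschitzWith_radialStretch b hs (scale_le_one m)
  set a : ℂ := multiplier b m * (scale m / 4 : ℝ) with ha
  set E₀ : ℂ → ℂ := fun z => (fderiv ℝ φ z v) • displacement (radialStretch b (scale m)) z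
    + φ z • displacementDeriv (radialStretch b (scale m)) z v with hE₀
  set E : Bool → ℂ → ℂ := fun ε z => (fderiv ℝ φ z v) • displacement (f (m + 1)) (childCoord m ε z)
    + φ z • ((scale m / 4)⁻¹ • displacementDeriv (f (m + 1)) (childCoord m ε z)) v with hE
  have hE₀i : Integrable E₀ volume :=
    (integrable_fderiv_smul hφ hc (continuous_displacement hLip.continuous).locallyIntegrable v).add
      (integrable_smul_clm_apply hφ hc
        (locallyIntegrable_displacementDeriv hLip.locallyIntegrable_fderiv) v)
  have hEi : ∀ ε, Integrable (E ε) volume := fun ε =>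
    integrable_displacement_comp_childCoord (h.continuous (m + 1)) (hL (m + 1)) m ε hφ hc v
  have hE₀z : ∫ z, E₀ z = 0 := by
    have := weakDefect_displacement hLip.continuous hLip.locallyIntegrable_fderiv hφ hc v
    rw [hLip.isWeakDeriv.weakDefect_eq_zero hLip.continuous.locallyIntegrable
      hLip.locallyIntegrable_fderiv hφ hc v] at this
    exact this
  have hEv : ∀ ε, ∫ z, E ε z = (scale m / 4 : ℝ) * weakDefect (displacement (f (m + 1)))
      (displacementDeriv (f (m + 1))) (childTest m ε φ) v := fun ε =>
    weakDefect_comp_childCoord m ε (displacement (f (m + 1))) (displacementDeriv (f (m + 1))) hφ v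
  have hsplit : weakDefect (displacement (f m)) (displacementDeriv (f m)) φ v
      = ∫ z, (E₀ z + (a * E true z + a * E false z)) := by
    refine integral_congr_ae ?_
    filter_upwards [hLip.ae_differentiableAt, ae_comp_childCoord m true (hd (m + 1)),
      ae_comp_childCoord m false (hd (m + 1))] with z h1 h2 h3
    have hGz : displacement (f m) z = displacement (radialStretch b (scale m)) z
        + (a * displacement (f (m + 1)) (childCoord m true z)
          + a * displacement (f (m + 1)) (childCoord m false z)) := by
      simp only [displacement]
      rw [h.eq]; ring
    have hDz := h.displacementDeriv_eq h1 (fun ε => by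
      cases ε
      · exact h3
      · exact h2)
    simp only [hE₀, hE]
    rw [hGz, hDz]
    simp only [add_apply, smul_apply, Complex.real_smul, smul_eq_mul, ha, Complex.ofReal_inv]
    field_simp
    ring
  have i1 : Integrable (fun z => a * E true z) volume := (hEi true).const_mul a
  have i2 : Integrable (fun z => a * E false z) volume := (hEi false).const_mul a
  have i3 : Integrable (fun z => a * E true z + a * E false z) volume := i1.add i2
  rw [hsplit, integral_add hE₀i i3, integral_add i1 i2, integral_const_mul, integral_const_mul,
    hE₀z, hEv, hEv, zero_add]

/-- The area of the unit disc bounds the Dirichlet integrals of all the maps at once, hence also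
their defects against test functions of a given size. -/
theorem exists_norm_weakDefect_le (h : IsPlantedFamily b f) (hb : -1 < b.re) {K : ℝ} (hK : 0 ≤ K)
    (hd : ∀ m, ∀ᵐ z, DifferentiableAt ℝ (f m) z ∧ HasDistortion K (fderiv ℝ (f m) z))
    {A : ℝ} (hA : 0 ≤ A) (v : ℂ) : ∃ C, 0 ≤ C ∧ ∀ (m : ℕ) (φ : ℂ → ℝ), (∀ z, ‖φ z‖ ≤ A) →
      (∀ z, ‖fderiv ℝ φ z v‖ ≤ A) →
        ‖weakDefect (displacement (f m)) (displacementDeriv (f m)) φ v‖ ≤ C := by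
  obtain ⟨B, hB⟩ := h.bounded
  have hB0 : 0 ≤ B := (norm_nonneg _).trans (hB 0 0)
  set S : Set ℂ := Metric.closedBall 0 1 with hS
  have hSm : MeasurableSet S := measurableSet_closedBall
  have hsq : ∀ m, Integrable (fun z => ‖fderiv ℝ (f m) z‖ ^ 2) (volume.restrict S) := fun m =>
    (locallyL2_fderiv hK (h.continuous m) (h.injective hb m) (hd m) S
      (isCompact_closedBall _ _)).integrable_norm_pow two_ne_zero
  have hSt : volume S ≠ ⊤ := measure_closedBall_lt_top.ne
  set M : ℝ := (ENNReal.ofReal (K ^ 3) * volume S).toReal with hM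
  have hsqM : ∀ m, ∫ z in S, ‖fderiv ℝ (f m) z‖ ^ 2 ≤ M := fun m => by
    rw [integral_eq_lintegral_of_nonneg_ae (Eventually.of_forall fun z => by positivity)
      (hsq m).aestronglyMeasurable]
    refine ENNReal.toReal_mono (ENNReal.mul_ne_top ENNReal.ofReal_ne_top hSt) ?_
    have h1 := lintegral_norm_fderiv_sq_le hK (h.injective hb m) (hd m) hSm
    have h2 : f m '' S ⊆ S := by
      rintro _ ⟨z, hz, rfl⟩
      rw [hS, mem_closedBall_zero_iff] at hz ⊢
      exact h.norm_le_one hb hz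
    refine le_trans (le_of_eq ?_) (h1.trans (by gcongr))
    refine lintegral_congr fun z => ?_
    rw [ENNReal.ofReal_pow (norm_nonneg _), ofReal_norm]
  refine ⟨A * (B + 2 * ‖v‖) * volume.real S + A * ‖v‖ * M, by positivity, ?_⟩
  intro m ψ hψA hψA'
  have i1 : Integrable (fun _ : ℂ => A * (B + 2 * ‖v‖)) (volume.restrict S) :=
    integrableOn_const hSt
  have i2 : Integrable (fun z => A * ‖v‖ * ‖fderiv ℝ (f m) z‖ ^ 2) (volume.restrict S) :=
    (hsq m).const_mul _
  have hint : Integrable (S.indicator fun z => A * (B + 2 * ‖v‖)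
      + A * ‖v‖ * ‖fderiv ℝ (f m) z‖ ^ 2) volume := by
    rw [integrable_indicator_iff hSm]
    exact i1.add i2
  refine (norm_integral_le_of_norm_le hint ?_).trans ?_
  · filter_upwards [ae_norm_ne 1] with z hz
    rcases lt_or_gt_of_ne hz with hz | hz
    · rw [Set.indicator_of_mem (by rw [hS, mem_closedBall_zero_iff]; exact hz.le)]
      refine (norm_add_le _ _).trans ?_
      rw [norm_smul, norm_smul]
      have h1 : ‖displacementDeriv (f m) z v‖ ≤ (2 + ‖fderiv ℝ (f m) z‖ ^ 2) * ‖v‖ := by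
        refine ((displacementDeriv (f m) z).le_opNorm v).trans ?_
        gcongr
        refine (norm_sub_le _ _).trans ?_
        have : ‖ContinuousLinearMap.id ℝ ℂ‖ ≤ 1 := ContinuousLinearMap.norm_id_le
        nlinarith [sq_nonneg (‖fderiv ℝ (f m) z‖ - 1)]
      calc _ ≤ A * B + A * ((2 + ‖fderiv ℝ (f m) z‖ ^ 2) * ‖v‖) := by
            gcongr
            · exact hψA' z
            · exact hB m z
            · exact hψA z
        _ = _ := by ring
    · have hev : f m =ᶠ[𝓝 z] ContinuousLinearMap.id ℝ ℂ := by
        filter_upwards [continuous_norm.continuousAt.eventually_const_lt hz] with w hw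
        rw [h.eq_id hb hw.le]; simp
      have h1 : displacementDeriv (f m) z = 0 := by
        rw [displacementDeriv, hev.fderiv_eq, ContinuousLinearMap.fderiv, sub_self]
      have h2 : displacement (f m) z = 0 := by rw [displacement, h.eq_id hb hz.le, sub_self]
      rw [h1, h2]
      simp only [smul_zero, zero_apply, add_zero, norm_zero]
      exact Set.indicator_nonneg (fun z _ => by positivity) z
  · rw [integral_indicator hSm, integral_add i1 i2, setIntegral_const, integral_const_mul,
      smul_eq_mul]
    have := hsqM m
    have h3 : A * ‖v‖ * ∫ z in S, ‖fderiv ℝ (f m) z‖ ^ 2 ≤ A * ‖v‖ * M := by gcongr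
    linarith

/-- The recursion makes the defect on one scale a small multiple of those on the next one; being
bounded, it vanishes. -/
theorem isWeakDeriv (h : IsPlantedFamily b f) (hb : -1 < b.re) {K : ℝ} (hK : 0 ≤ K)
    (hd : ∀ m, ∀ᵐ z, DifferentiableAt ℝ (f m) z ∧ HasDistortion K (fderiv ℝ (f m) z)) (m : ℕ) :
    IsWeakDeriv (f m) (fderiv ℝ (f m)) := by
  have hL : ∀ m, LocallyIntegrable (fderiv ℝ (f m)) volume := fun m =>
    (locallyL2_fderiv hK (h.continuous m) (h.injective hb m) (hd m)).locallyIntegrable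
  have hd' : ∀ m, ∀ᵐ z, DifferentiableAt ℝ (f m) z := fun m => (hd m).mono fun _ hz => hz.1
  intro φ hφ hc v
  obtain ⟨A₁, hA₁⟩ := hφ.continuous.bounded_above_of_compact_support hc
  obtain ⟨A₂, hA₂⟩ := ((hφ.continuous_fderiv (by simp)).clm_apply
    continuous_const).bounded_above_of_compact_support (hc.fderiv_apply (𝕜 := ℝ) v)
  set A := max A₁ A₂
  have hA0 : 0 ≤ A := (norm_nonneg _).trans ((hA₁ 0).trans (le_max_left _ _))
  obtain ⟨C₀, hC₀, hbd⟩ := h.exists_norm_weakDefect_le hb hK hd hA0 v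
  have key := forall_le_zero_of_contraction
    (ι := {p : ℕ × (ℂ → ℝ) // ContDiff ℝ ∞ p.2 ∧ HasCompactSupport p.2 ∧ (∀ z, ‖p.2 z‖ ≤ A) ∧
      ∀ z, ‖fderiv ℝ p.2 z v‖ ≤ A})
    (u := fun p => ‖weakDefect (displacement (f p.1.1)) (displacementDeriv (f p.1.1)) p.1.2 v‖)
    hC₀ (fun p => hbd _ _ p.2.2.2.1 p.2.2.2.2) (by
      rintro C hC hu ⟨⟨m, ψ⟩, hψ, hψc, hψA, hψA'⟩
      simp only at hψ hψc hψA hψA' ⊢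
      have hs := scale_pos m
      have hs2 := scale_lt_half m
      have hstep : ∀ ε, ‖multiplier b m * (scale m / 4 : ℝ) * ((scale m / 4 : ℝ) *
          weakDefect (displacement (f (m + 1))) (displacementDeriv (f (m + 1)))
            (childTest m ε ψ) v)‖ ≤ C / 4 := fun ε => by
        have h1 := hu ⟨(m + 1, childTest m ε ψ), contDiff_childTest m ε hψ,
          hasCompactSupport_childTest m ε hψc, fun w => hψA _, fun w => by
            simp only
            rw [fderiv_childTest m ε hψ, norm_mul, Real.norm_of_nonneg (by positivity)]
            have := hψA' (childCenter m ε + (scale m / 4) • w)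
            nlinarith [norm_nonneg (fderiv ℝ ψ (childCenter m ε + (scale m / 4) • w) v)]⟩
        simp only at h1
        have h2 := norm_multiplier_mul_scale_le hb m
        rw [norm_mul, norm_mul, norm_mul, Complex.norm_real, Real.norm_of_nonneg (by positivity)]
        calc _ = ‖multiplier b m‖ * scale m * (scale m / 16) *
              ‖weakDefect (displacement (f (m + 1))) (displacementDeriv (f (m + 1)))
                (childTest m ε ψ) v‖ := by ring
          _ ≤ 1 * (1 / 4) * C := by
              have : scale m / 16 ≤ 1 / 4 := by linarith
              gcongr
          _ = C / 4 := by ring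
      rw [h.weakDefect_displacement_eq hL hd' m hψ hψc v]
      refine (norm_add_le _ _).trans ?_
      linarith [hstep true, hstep false]) ⟨(m, φ), hφ, hc, fun z => (hA₁ z).trans (le_max_left _ _),
        fun z => (hA₂ z).trans (le_max_right _ _)⟩
  have hzero := norm_le_zero_iff.1 key
  simp only at hzero
  rw [weakDefect_displacement (h.continuous m) (hL m) hφ hc v] at hzero
  rw [eq_neg_iff_add_eq_zero, ← integral_add
    (integrable_fderiv_smul hφ hc (h.continuous m).locallyIntegrable v)
    (integrable_smul_clm_apply hφ hc (hL m) v)]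
  exact hzero

/-- The members of the planted family are quasiconformal with the distortion bound of the radial
maps they are assembled from. -/
theorem isQuasiconformal (h : IsPlantedFamily b f) (hb : -1 < b.re) {K : ℝ} (hK : 1 ≤ K)
    (hR : ∀ m, ∀ᵐ z, DifferentiableAt ℝ (radialStretch b (scale m)) z ∧
      HasDistortion K (fderiv ℝ (radialStretch b (scale m)) z)) (m : ℕ) :
    IsQuasiconformal K (f m) := by
  have hd := h.ae_hasDistortion hb hK hR
  have hK0 : 0 ≤ K := by linarith
  refine ⟨h.isHomeomorph hb m, orientationPreserving_of_eq_id (h.continuous m) (h.injective hb m)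
    fun z hz => h.eq_id hb hz, fderiv ℝ (f m), ⟨locallyL2_of_continuous (h.continuous m),
      locallyL2_fderiv hK0 (h.continuous m) (h.injective hb m) (hd m),
      h.isWeakDeriv hb hK0 hd m⟩, ?_⟩
  filter_upwards [hd m] with z hz
  exact hz.2

end IsPlantedFamily

/-! ### The Cantor set of nested child discs -/

/-- The point with address `σ` in the limit set of the child discs of generations `m, m + 1, …`. -/
noncomputable def cantorPoint (m : ℕ) (σ : ℕ → Bool) : ℂ :=
  ∑' k, ((∏ j ∈ Finset.range k, scale (m + j) / 4 : ℝ) : ℂ) * childCenter (m + k) (σ k)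

theorem norm_cantorPoint_term_le (m : ℕ) (σ : ℕ → Bool) (k : ℕ) :
    ‖((∏ j ∈ Finset.range k, scale (m + j) / 4 : ℝ) : ℂ) * childCenter (m + k) (σ k)‖
      ≤ 1 / 4 * (1 / 2) ^ k := by
  have h1 : ‖((∏ j ∈ Finset.range k, scale (m + j) / 4 : ℝ) : ℂ)‖ ≤ (1 / 2) ^ k := by
    rw [Complex.norm_real, Real.norm_of_nonneg
      (Finset.prod_nonneg fun j _ => by have := scale_pos (m + j); positivity)]
    refine (Finset.prod_le_prod (g := fun _ => 1 / 2) (fun j _ => ?_) fun j _ => ?_).trans_eq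
      (by simp)
    · have := scale_pos (m + j)
      positivity
    · linarith [scale_lt_half (m + j), scale_pos (m + j)]
  rw [norm_mul, norm_childCenter, mul_comm]
  have := scale_lt_half (m + k)
  exact mul_le_mul (by linarith) h1 (norm_nonneg _) (by norm_num)

theorem hasSum_half_pow : HasSum (fun k : ℕ => 1 / 4 * (1 / 2 : ℝ) ^ k) (1 / 2) := by
  have := hasSum_geometric_two.mul_left (1 / 4 : ℝ)
  norm_num at this ⊢
  exact this

theorem summable_cantorPoint (m : ℕ) (σ : ℕ → Bool) : Summable fun k =>
    ((∏ j ∈ Finset.range k, scale (m + j) / 4 : ℝ) : ℂ) * childCenter (m + k) (σ k) :=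
  Summable.of_norm_bounded hasSum_half_pow.summable (norm_cantorPoint_term_le m σ)

theorem norm_cantorPoint_le_one (m : ℕ) (σ : ℕ → Bool) : ‖cantorPoint m σ‖ ≤ 1 :=
  (tsum_of_norm_bounded hasSum_half_pow (norm_cantorPoint_term_le m σ)).trans (by norm_num)

theorem cantorPoint_eq (m : ℕ) (σ : ℕ → Bool) : cantorPoint m σ =
    childCenter m (σ 0) + (scale m / 4 : ℝ) * cantorPoint (m + 1) (fun k => σ (k + 1)) := by
  rw [cantorPoint, (summable_cantorPoint m σ).tsum_eq_zero_add, cantorPoint, ← tsum_mul_left]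
  congr 1
  · simp
  · refine tsum_congr fun k => ?_
    rw [Finset.prod_range_succ', add_zero, show m + (k + 1) = m + 1 + k by ring]
    have : ∏ j ∈ Finset.range k, scale (m + (j + 1)) / 4
        = ∏ j ∈ Finset.range k, scale (m + 1 + j) / 4 :=
      Finset.prod_congr rfl fun j _ => by rw [show m + (j + 1) = m + 1 + j by ring]
    rw [this, Complex.ofReal_mul]
    ring

theorem childCoord_cantorPoint (m : ℕ) (σ : ℕ → Bool) :
    childCoord m (σ 0) (cantorPoint m σ) = cantorPoint (m + 1) (fun k => σ (k + 1)) := by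
  rw [cantorPoint_eq, childCoord_childCenter_add]

theorem norm_cantorPoint_le (m : ℕ) (σ : ℕ → Bool) : ‖cantorPoint m σ‖ ≤ 3 / 4 * scale m := by
  apply norm_le_of_childCoord (ε := σ 0)
  rw [childCoord_cantorPoint]
  exact norm_cantorPoint_le_one _ _

/-- The address is recovered from the point, because the children are disjoint. -/
theorem cantorPoint_injective (m : ℕ) : Function.Injective (cantorPoint m) := by
  have key : ∀ (k m : ℕ) (σ σ' : ℕ → Bool), cantorPoint m σ = cantorPoint m σ' → σ k = σ' k := by
    intro k
    have h0 : ∀ (m : ℕ) (σ σ' : ℕ → Bool), cantorPoint m σ = cantorPoint m σ' → σ 0 = σ' 0 := by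
      intro m σ σ' h
      by_contra hne
      have h1 := norm_cantorPoint_le_one (m + 1) (fun k => σ (k + 1))
      have h2 := norm_cantorPoint_le_one (m + 1) (fun k => σ' (k + 1))
      rw [← childCoord_cantorPoint] at h1 h2
      have h3 : σ' 0 = !(σ 0) := by
        revert hne; cases σ 0 <;> cases σ' 0 <;> simp
      rw [← h, h3] at h2
      exact absurd (one_lt_norm_childCoord_not h1) (not_lt.2 h2)
    induction k with
    | zero => exact h0
    | succ k ih =>
      intro m σ σ' h
      refine ih (m + 1) (fun k => σ (k + 1)) (fun k => σ' (k + 1)) ?_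
      rw [← childCoord_cantorPoint, ← childCoord_cantorPoint, h, h0 m σ σ' h]
  intro σ σ' h
  funext k
  exact key k m σ σ' h

theorem not_countable_range_cantorPoint (m : ℕ) : ¬ (Set.range (cantorPoint m)).Countable := by
  intro h
  have h1 : (Set.univ : Set (ℕ → Bool)).Countable := by
    rw [← Set.image_univ] at h
    exact Set.countable_of_injective_of_countable_image (cantorPoint_injective m).injOn h
  have h2 := Set.countable_univ_iff.1 h1
  have h3 := Cardinal.mk_le_aleph0 (α := ℕ → Bool)
  rw [Cardinal.mk_arrow, Cardinal.mk_bool, Cardinal.lift_id, Cardinal.lift_id] at h3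
  rw [Cardinal.mk_nat] at h3
  exact absurd h3 (not_le.2 (Cardinal.cantor _))

/-! ### Leaving a disc along a horizontal ray -/

/-- The time at which the horizontal ray to the right from `z` leaves the disc of radius `ρ`. -/
noncomputable def exitTime (ρ : ℝ) (z : ℂ) : ℝ := Real.sqrt (ρ ^ 2 - z.im ^ 2) - z.re

section exitTime

variable {ρ : ℝ} {z : ℂ}

theorem norm_add_ofReal_sq (z : ℂ) (t : ℝ) : ‖z + t‖ ^ 2 = (z.re + t) ^ 2 + z.im ^ 2 := by
  rw [Complex.sq_norm, Complex.normSq_apply]; simp; ring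

theorem im_sq_lt_of_norm_lt (hρ : 0 < ρ) (hz : ‖z‖ < ρ) : z.re ^ 2 < ρ ^ 2 - z.im ^ 2 := by
  have h1 := norm_add_ofReal_sq z 0
  simp only [Complex.ofReal_zero, add_zero] at h1
  nlinarith [norm_nonneg z]

theorem norm_add_exitTime (hρ : 0 < ρ) (hz : ‖z‖ < ρ) : ‖z + exitTime ρ z‖ = ρ := by
  have h1 := im_sq_lt_of_norm_lt hρ hz
  have h2 := norm_add_ofReal_sq z (exitTime ρ z)
  rw [exitTime, add_sub_cancel, Real.sq_sqrt (by nlinarith [sq_nonneg z.re])] at h2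
  have h3 : ‖z + exitTime ρ z‖ ^ 2 = ρ ^ 2 := by rw [exitTime, h2]; ring
  exact (pow_left_inj₀ (norm_nonneg _) hρ.le two_ne_zero).1 h3

theorem abs_re_lt_sqrt (hρ : 0 < ρ) (hz : ‖z‖ < ρ) : |z.re| < Real.sqrt (ρ ^ 2 - z.im ^ 2) :=
  Real.lt_sqrt_of_sq_lt (by rw [sq_abs]; exact im_sq_lt_of_norm_lt hρ hz)

theorem exitTime_pos (hρ : 0 < ρ) (hz : ‖z‖ < ρ) : 0 < exitTime ρ z := by
  have := (abs_lt.1 (abs_re_lt_sqrt hρ hz)).2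
  rw [exitTime]; linarith

theorem re_pos_of_exitTime_le (hρ : 0 < ρ) (hz : ‖z‖ < ρ) {t : ℝ} (ht : exitTime ρ z ≤ t) :
    0 < (z + t).re := by
  have := abs_re_lt_sqrt hρ hz
  have := abs_nonneg z.re
  rw [exitTime] at ht
  simp only [Complex.add_re, Complex.ofReal_re]
  linarith

theorem le_norm_of_exitTime_le (hρ : 0 < ρ) (hz : ‖z‖ < ρ) {t : ℝ} (ht : exitTime ρ z ≤ t) :
    ρ ≤ ‖z + t‖ := by
  have h1 := im_sq_lt_of_norm_lt hρ hz
  have h2 := norm_add_ofReal_sq z t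
  have h3 := Real.sq_sqrt (show 0 ≤ ρ ^ 2 - z.im ^ 2 by nlinarith [sq_nonneg z.re])
  have h4 := Real.sqrt_nonneg (ρ ^ 2 - z.im ^ 2)
  rw [exitTime] at ht
  refine (pow_le_pow_iff_left₀ hρ.le (norm_nonneg _) two_ne_zero).1 ?_
  nlinarith

theorem norm_le_of_le_exitTime (hρ : 0 < ρ) (hz : ‖z‖ < ρ) {t : ℝ} (h0 : 0 ≤ t)
    (ht : t ≤ exitTime ρ z) : ‖z + t‖ ≤ ρ := by
  have h1 := im_sq_lt_of_norm_lt hρ hz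
  have h2 := norm_add_ofReal_sq z t
  have h3 := Real.sq_sqrt (show 0 ≤ ρ ^ 2 - z.im ^ 2 by nlinarith [sq_nonneg z.re])
  have h4 := abs_lt.1 (abs_re_lt_sqrt hρ hz)
  rw [exitTime] at ht
  refine (pow_le_pow_iff_left₀ (norm_nonneg _) hρ.le two_ne_zero).1 ?_
  nlinarith

theorem exitTime_mono {ρ' : ℝ} (hρ : 0 ≤ ρ) (h : ρ ≤ ρ') (z : ℂ) :
    exitTime ρ z ≤ exitTime ρ' z := by
  unfold exitTime
  gcongr

theorem exitTime_le (hρ : 0 < ρ) (hz : ‖z‖ < ρ) : exitTime ρ z ≤ ρ + ‖z‖ := by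
  have h1 := norm_sub_le (z + exitTime ρ z) z
  rw [norm_add_exitTime hρ hz, add_sub_cancel_left, Complex.norm_real] at h1
  exact (le_abs_self _).trans h1

theorem le_exitTime (hρ : 0 < ρ) (hz : ‖z‖ < ρ) : ρ - ‖z‖ ≤ exitTime ρ z := by
  have h1 := norm_add_le z (exitTime ρ z)
  rw [norm_add_exitTime hρ hz, Complex.norm_real,
    Real.norm_of_nonneg (exitTime_pos hρ hz).le] at h1
  linarith

end exitTime

theorem norm_cantorPoint_lt (m : ℕ) (σ : ℕ → Bool) : ‖cantorPoint m σ‖ < scale m := by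
  linarith [norm_cantorPoint_le m σ, scale_pos m]

theorem childCoord_cantorPoint_add (m : ℕ) (σ : ℕ → Bool) (t : ℝ) :
    childCoord m (σ 0) (cantorPoint m σ + t)
      = cantorPoint (m + 1) (fun k => σ (k + 1)) + (t / (scale m / 4) : ℝ) := by
  rw [← childCoord_cantorPoint, childCoord, childCoord]
  push_cast
  ring

/-- The ray from a point of one child does not meet the other child. -/
theorem one_le_norm_childCoord_not (m : ℕ) (σ : ℕ → Bool) (t : ℝ) :
    1 ≤ ‖childCoord m (!(σ 0)) (cantorPoint m σ + t)‖ := by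
  have hs : (scale m : ℂ) ≠ 0 := by exact_mod_cast (scale_pos m).ne'
  have e : childCoord m (!(σ 0)) (cantorPoint m σ + t)
      = (cantorPoint (m + 1) (fun k => σ (k + 1)) + (t / (scale m / 4) : ℝ))
        + (if σ 0 then 4 else -4 : ℝ) * Complex.I := by
    rw [← childCoord_cantorPoint_add]
    cases σ 0 <;> simp [childCoord, childCenter] <;> field_simp <;> ring
  have h1 := Complex.abs_im_le_norm (childCoord m (!(σ 0)) (cantorPoint m σ + t))
  have h2 := (Complex.abs_im_le_norm (cantorPoint (m + 1) (fun k => σ (k + 1)))).trans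
    (norm_cantorPoint_le_one _ _)
  refine le_trans ?_ h1
  rw [e]
  simp only [Complex.add_im, Complex.ofReal_im, Complex.mul_im, Complex.I_im, Complex.I_re,
    Complex.ofReal_re, mul_one, mul_zero, add_zero]
  rw [abs_le] at h2
  rw [le_abs]
  cases σ 0
  · right; simp; linarith
  · left; simp; linarith

/-- The rotation of one spiral. -/
theorem multiplier_eq_norm_mul_exp (b : ℂ) (m : ℕ) : multiplier b m =
    (‖multiplier b m‖ : ℂ) * Complex.exp ((b.im * Real.log (scale m) : ℝ) * Complex.I) := by
  have := eq_norm_mul_exp_im (L := b * Real.log (scale m)) (F := multiplier b m) rfl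
  rwa [Complex.im_mul_ofReal] at this

theorem childExit_lt_exitTime (m : ℕ) (σ : ℕ → Bool) :
    scale m / 4 * exitTime 1 (cantorPoint (m + 1) (fun k => σ (k + 1)))
      < exitTime (scale m) (cantorPoint m σ) := by
  have hs := scale_pos m
  have hz1 : ‖cantorPoint (m + 1) (fun k => σ (k + 1))‖ < 1 :=
    (norm_cantorPoint_lt _ _).trans_le (scale_le_one _)
  by_contra hc
  have h1 := le_norm_of_exitTime_le hs (norm_cantorPoint_lt m σ) (not_lt.1 hc)
  have h2 := norm_le_of_childCoord (m := m) (ε := σ 0) (z := cantorPoint m σ + (scale m / 4 *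
    exitTime 1 (cantorPoint (m + 1) (fun k => σ (k + 1))) : ℝ)) (by
      rw [childCoord_cantorPoint_add, mul_div_cancel_left₀ _ (by positivity),
        norm_add_exitTime one_pos hz1])
  linarith

/-! ### The image of the ray, one generation at a time -/

namespace IsPlantedFamily

variable {b : ℂ} {f : ℕ → ℂ → ℂ}

/-- The image of a Cantor point is the image, under the linear part of the radial map, of a point in
the child disc (in general not the Cantor point itself). -/
theorem apply_cantorPoint (h : IsPlantedFamily b f) (hb : -1 < b.re) (m : ℕ) (σ : ℕ → Bool) :
    ∃ p, f m (cantorPoint m σ) = multiplier b m * p ∧ ‖p‖ ≤ 3 / 4 * scale m := by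
  refine ⟨childCenter m (σ 0) + (scale m / 4 : ℝ) * f (m + 1) (cantorPoint (m + 1)
    fun k => σ (k + 1)), ?_, ?_⟩
  · rw [h.eq_child hb (ε := σ 0), childCoord_cantorPoint]
    rw [childCoord_cantorPoint]
    exact norm_cantorPoint_le_one _ _
  · exact norm_childCenter_add_le _ _ (h.norm_le_one hb (norm_cantorPoint_le_one _ _))

/-- Outside the disc of radius `scale m` the image of the ray is compared with the spiral
`radialStretch b (scale m) (z + t)`: the two stay within a half-plane of each other. -/
theorem abs_rayArg_sub_le (h : IsPlantedFamily b f) (hb : -1 < b.re) (m : ℕ) (σ : ℕ → Bool)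
    {θ : ℝ → ℝ} (hθ : IsRayArg (f m) (cantorPoint m σ) θ) {t : ℝ}
    (ht : exitTime (scale m) (cantorPoint m σ) ≤ t) :
    |θ t - b.im * logClamp (scale m) ‖cantorPoint m σ + t‖| ≤ 2 * Real.pi := by
  set z := cantorPoint m σ with hz
  have hs := scale_pos m
  have hs1 := scale_le_one m
  have hzs : ‖z‖ < scale m := norm_cantorPoint_lt m σ
  set t₀ := exitTime (scale m) z with ht₀
  have ht₀p : 0 < t₀ := exitTime_pos hs hzs
  set ψ : ℝ → ℝ := fun t => Complex.arg (z + t) + b.im * logClamp (scale m) ‖z + t‖ with hψ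
  obtain ⟨p, hp, hpn⟩ := h.apply_cantorPoint hb m σ
  have hfz : f m z = radialStretch b (scale m) p := by
    rw [radialStretch_of_le hs1 (by linarith), hz, hp, multiplier, mul_comm]
  have hψc : ContinuousOn ψ (Set.Ici t₀) := by
    refine ContinuousOn.add (fun t ht => ?_) ?_
    · exact (ContinuousAt.comp (f := fun t : ℝ => z + (t : ℂ)) (Complex.continuousAt_arg
        (Or.inl (re_pos_of_exitTime_le hs hzs ht))) (by fun_prop)).continuousWithinAt
    · have := continuous_logClamp hs
      fun_prop
  have hcos : ∀ t ∈ Set.Ici t₀, Real.cos (θ t - ψ t - 0) ≠ 0 := by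
    intro t ht h0
    have hr := le_norm_of_exitTime_le hs hzs ht
    have hne : z + t ≠ 0 := norm_pos_iff.1 (hs.trans_le hr)
    have hft : f m (z + t) = radialStretch b (scale m) (z + t) :=
      h.eq_radialStretch hb fun ε => (one_lt_norm_childCoord (by linarith) ε).le
    set Q := radialStretch b (scale m) (z + t) with hQ
    have hQn : ‖radialStretch b (scale m) p‖ < ‖Q‖ := norm_radialStretch_lt hs hb (by linarith)
    have hQ0 : 0 < ‖Q‖ := (norm_nonneg _).trans_lt hQn
    have hQe : Q = (‖Q‖ : ℂ) * Complex.exp (ψ t * Complex.I) := by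
      rw [hQ, norm_radialStretch, radialStretch]
      conv_lhs => rw [← Complex.norm_mul_exp_arg_mul_I (z + t)]
      have e : b * (logClamp (scale m) ‖z + t‖ : ℂ) = ((b.re * logClamp (scale m) ‖z + t‖ : ℝ) : ℂ)
          + ((b.im * logClamp (scale m) ‖z + t‖ : ℝ) : ℂ) * Complex.I := by
        conv_lhs => rw [← Complex.re_add_im b]
        push_cast; ring
      have : ‖(‖z + t‖ : ℂ) * Complex.exp ((z + t).arg * Complex.I)‖ = ‖z + t‖ := by
        rw [Complex.norm_mul_exp_arg_mul_I]
      rw [this, e, Complex.exp_add, hψ]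
      simp only [Complex.ofReal_mul, Complex.ofReal_exp, Complex.ofReal_add, add_mul,
        Complex.exp_add]
      ring
    have h1 := hθ.arg_eq t (ht₀p.trans_le ht)
    rw [hft, hfz] at h1
    set F := Q - radialStretch b (scale m) p
    have h2 : F * (starRingEnd ℂ) Q = ((‖F‖ * ‖Q‖ : ℝ) : ℂ) *
        Complex.exp ((θ t - ψ t : ℝ) * Complex.I) := by
      conv_lhs => rw [h1, hQe]
      rw [map_mul, Complex.conj_ofReal, ← Complex.exp_conj, map_mul, Complex.conj_I,
        Complex.conj_ofReal]
      push_cast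
      rw [sub_mul, sub_eq_add_neg, Complex.exp_add, mul_neg]
      ring
    have h3 : (F * (starRingEnd ℂ) Q).re = 0 := by
      rw [h2, Complex.re_ofReal_mul, Complex.exp_ofReal_mul_I_re]
      rw [sub_zero] at h0
      rw [h0, mul_zero]
    have h4 : (F * (starRingEnd ℂ) Q).re
        = ‖Q‖ ^ 2 - (radialStretch b (scale m) p * (starRingEnd ℂ) Q).re := by
      rw [sub_mul, Complex.sub_re, Complex.mul_conj, Complex.ofReal_re, Complex.sq_norm]
    have h5 := (Complex.abs_re_le_norm (radialStretch b (scale m) p * (starRingEnd ℂ) Q))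
    rw [norm_mul, Complex.norm_conj] at h5
    have h6 := (abs_le.1 h5).2
    nlinarith
  have hlim : Tendsto (fun s => |(θ t - ψ t) - (θ s - ψ s)|) atTop (𝓝 |θ t - ψ t|) := by
    have hψl : Tendsto ψ atTop (𝓝 0) := by
      have h1 := tendsto_arg_add_atTop z
      refine h1.congr' ?_
      filter_upwards [eventually_ge_atTop (exitTime 1 z)] with s hs'
      have : 1 ≤ ‖z + s‖ := le_norm_of_exitTime_le one_pos (by linarith) hs'
      rw [hψ]; simp only
      rw [logClamp_of_one_le hs1 this]; simp
    have := ((hθ.tendsto_zero.sub hψl).const_sub (θ t - ψ t)).abs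
    simpa using this
  have hle : |θ t - ψ t| ≤ Real.pi := by
    refine le_of_tendsto hlim ?_
    filter_upwards [eventually_ge_atTop t₀] with s hs'
    exact (abs_sub_lt_pi_of_cos_ne_zero isPreconnected_Ici
      ((hθ.continuousOn.mono fun t ht => ht₀p.trans_le ht).sub hψc) 0 hcos ht hs').le
  have harg := Complex.abs_arg_le_pi (z + t)
  have e : θ t - b.im * logClamp (scale m) ‖z + t‖ = (θ t - ψ t) + Complex.arg (z + t) := by
    rw [hψ]; ring
  rw [e]
  refine (abs_add_le _ _).trans ?_
  linarith

/-- Between the boundary of the child and the circle of radius `scale m` the map is linear, and the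
image of the ray is a segment. -/
theorem abs_rayArg_sub_lt_pi (h : IsPlantedFamily b f) (hb : -1 < b.re) (m : ℕ) (σ : ℕ → Bool)
    {θ : ℝ → ℝ} (hθ : IsRayArg (f m) (cantorPoint m σ) θ) :
    |θ (scale m / 4 * exitTime 1 (cantorPoint (m + 1) (fun k => σ (k + 1))))
      - θ (exitTime (scale m) (cantorPoint m σ))| < Real.pi := by
  have hz1 : ‖cantorPoint (m + 1) (fun k => σ (k + 1))‖ < 1 :=
    (norm_cantorPoint_lt _ _).trans_le (scale_le_one _)
  have h01 := childExit_lt_exitTime m σ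
  set t₁ := scale m / 4 * exitTime 1 (cantorPoint (m + 1) (fun k => σ (k + 1))) with ht₁
  have h0 : 0 < t₁ := by
    have := scale_pos m
    have := exitTime_pos one_pos hz1
    positivity
  have hcr : ∀ t, t₁ ≤ t →
      1 ≤ ‖cantorPoint (m + 1) (fun k => σ (k + 1)) + (t / (scale m / 4) : ℝ)‖ := fun t ht => by
    have := scale_pos m
    refine le_norm_of_exitTime_le one_pos hz1 ?_
    rw [le_div_iff₀ (by positivity), mul_comm]
    exact ht
  set z := cantorPoint m σ with hz
  have hs := scale_pos m
  have hs1 := scale_le_one m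
  have hzs : ‖z‖ < scale m := norm_cantorPoint_lt m σ
  set t₀ := exitTime (scale m) z with ht₀
  obtain ⟨p, hp, hpn⟩ := h.apply_cantorPoint hb m σ
  set a : ℝ := b.im * Real.log (scale m) with ha
  have hln : 0 < ‖multiplier b m‖ := norm_pos_iff.2 (multiplier_ne_zero b m)
  -- the rotated image of the ray has constant imaginary part
  have key : ∀ t ∈ Set.Icc t₁ t₀, ‖f m (z + t) - f m z‖ / ‖multiplier b m‖ *
      Real.sin (θ t - a) = (z - p).im := by
    intro t ht
    have htp := h0.trans_le ht.1
    have hft : f m (z + t) = multiplier b m * (z + t) := by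
      rw [h.eq_radialStretch hb, radialStretch_of_le hs1
        (norm_le_of_le_exitTime hs hzs htp.le ht.2), multiplier, mul_comm]
      intro ε
      by_cases hε : ε = σ 0
      · rw [hε, hz, childCoord_cantorPoint_add]; exact hcr t ht.1
      · have : ε = !(σ 0) := by revert hε; cases ε <;> cases σ 0 <;> simp
        rw [this]; exact one_le_norm_childCoord_not m σ t
    have h2 := hθ.arg_eq t htp
    set N := ‖f m (z + t) - f m z‖
    rw [hft, hp, ← mul_sub, multiplier_eq_norm_mul_exp] at h2
    have hlc : (‖multiplier b m‖ : ℂ) ≠ 0 := by exact_mod_cast hln.ne'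
    have h3 : z + t - p = ((N / ‖multiplier b m‖ : ℝ) : ℂ) *
        Complex.exp ((θ t - a : ℝ) * Complex.I) := by
      push_cast
      rw [sub_mul, Complex.exp_sub]
      field_simp
      rw [← h2]
      simp only [ha]
      push_cast
      ring_nf
    have h4 := congrArg Complex.im h3
    rw [Complex.im_ofReal_mul, Complex.exp_ofReal_mul_I_im] at h4
    rw [← h4]; simp
  have hN : ∀ t ∈ Set.Icc t₁ t₀, 0 < ‖f m (z + t) - f m z‖ / ‖multiplier b m‖ := by
    intro t ht
    refine div_pos (norm_pos_iff.2 fun hc => ?_) hln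
    have := h.injective hb m (sub_eq_zero.1 hc)
    simp only [add_eq_left, Complex.ofReal_eq_zero] at this
    exact (h0.trans_le ht.1).ne' this
  have hcont : ContinuousOn θ (Set.Icc t₁ t₀) := hθ.continuousOn.mono fun t ht => h0.trans_le ht.1
  by_cases hy : (z - p).im = 0
  · refine abs_sub_lt_pi_of_cos_ne_zero isPreconnected_Icc hcont a (fun t ht hc => ?_)
      (Set.left_mem_Icc.2 h01.le) (Set.right_mem_Icc.2 h01.le)
    have h2 := key t ht
    rw [hy] at h2
    have h3 := (mul_eq_zero.1 h2).resolve_left (hN t ht).ne'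
    have := Real.sin_sq_add_cos_sq (θ t - a)
    rw [h3, hc] at this
    norm_num at this
  · refine abs_sub_lt_pi_of_cos_ne_zero isPreconnected_Icc hcont (a + Real.pi / 2)
      (fun t ht hc => ?_) (Set.left_mem_Icc.2 h01.le) (Set.right_mem_Icc.2 h01.le)
    rw [← sub_sub, Real.cos_sub_pi_div_two] at hc
    have h2 := key t ht
    rw [hc, mul_zero] at h2
    exact hy h2.symm

/-- Inside the child, `f m` is a similar copy of `f (m + 1)`. -/
theorem apply_add_sub_of_child (h : IsPlantedFamily b f) (hb : -1 < b.re) (m : ℕ) (σ : ℕ → Bool)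
    {s : ℝ} (hs : ‖cantorPoint (m + 1) (fun k => σ (k + 1)) + s‖ ≤ 1) :
    f m (cantorPoint m σ + (scale m / 4 * s : ℝ)) - f m (cantorPoint m σ) =
      multiplier b m * (scale m / 4 : ℝ) * (f (m + 1) (cantorPoint (m + 1) (fun k => σ (k + 1)) + s)
        - f (m + 1) (cantorPoint (m + 1) (fun k => σ (k + 1)))) := by
  have hsc := scale_pos m
  have e : childCoord m (σ 0) (cantorPoint m σ + (scale m / 4 * s : ℝ))
      = cantorPoint (m + 1) (fun k => σ (k + 1)) + s := by
    rw [childCoord_cantorPoint_add, mul_div_cancel_left₀ _ (by positivity)]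
  rw [h.eq_child hb (ε := σ 0) (by rwa [e]), h.eq_child hb (z := cantorPoint m σ) (ε := σ 0)
    (by rw [childCoord_cantorPoint]; exact norm_cantorPoint_le_one _ _), e, childCoord_cantorPoint]
  ring

end IsPlantedFamily

/-! ### Observation scales -/

/-- The `n`-th observation scale at a Cantor point: `n` generations down, the ray leaves the disc on
which the map of that generation is linear. -/
noncomputable def observationScale : (n : ℕ) → (m : ℕ) → (ℕ → Bool) → ℝ
  | 0, m, σ => exitTime (scale m) (cantorPoint m σ)
  | n + 1, m, σ => scale m / 4 * observationScale n (m + 1) fun k => σ (k + 1)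

/-- The logarithm of the product of the ratios of the annuli of generations `m, …, m + n`. -/
noncomputable def logScaleSum (n m : ℕ) : ℝ := -((n + 1) * (m + 1) + n * (n + 1) / 2)

theorem logScaleSum_zero (m : ℕ) : logScaleSum 0 m = Real.log (scale m) := by
  rw [logScaleSum, log_scale]; simp

theorem logScaleSum_succ (n m : ℕ) :
    logScaleSum (n + 1) m = Real.log (scale m) + logScaleSum n (m + 1) := by
  rw [logScaleSum, logScaleSum, log_scale]; push_cast; ring

theorem observationScale_pos (n : ℕ) : ∀ (m : ℕ) (σ : ℕ → Bool), 0 < observationScale n m σ := by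
  induction n with
  | zero => exact fun m σ => exitTime_pos (scale_pos m) (norm_cantorPoint_lt m σ)
  | succ n ih =>
    intro m σ
    have := scale_pos m
    have := ih (m + 1) fun k => σ (k + 1)
    rw [observationScale]
    positivity

theorem observationScale_le_exitTime (n : ℕ) : ∀ (m : ℕ) (σ : ℕ → Bool),
    observationScale n m σ ≤ exitTime (scale m) (cantorPoint m σ) := by
  induction n with
  | zero => exact fun m σ => le_rfl
  | succ n ih =>
    intro m σ
    have hs := scale_pos m
    refine le_trans ?_ (childExit_lt_exitTime m σ).le
    rw [observationScale]
    gcongr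
    exact (ih _ _).trans (exitTime_mono (scale_pos _).le (scale_le_one _) _)

theorem observationScale_succ_lt (n : ℕ) : ∀ (m : ℕ) (σ : ℕ → Bool),
    observationScale (n + 1) m σ < observationScale n m σ := by
  induction n with
  | zero =>
    intro m σ
    have hs := scale_pos m
    refine lt_of_le_of_lt ?_ (childExit_lt_exitTime m σ)
    rw [observationScale]
    gcongr
    exact exitTime_mono (scale_pos _).le (scale_le_one _) _
  | succ n ih =>
    intro m σ
    have hs := scale_pos m
    exact mul_lt_mul_of_pos_left (ih _ _) (by positivity)

theorem observationScale_le_pow (n : ℕ) : ∀ (m : ℕ) (σ : ℕ → Bool),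
    observationScale n m σ ≤ (1 / 2) ^ n := by
  induction n with
  | zero =>
    intro m σ
    have h1 := exitTime_le (scale_pos m) (norm_cantorPoint_lt m σ)
    have h2 := norm_cantorPoint_le m σ
    have h3 := scale_lt_half m
    rw [observationScale, pow_zero]
    linarith
  | succ n ih =>
    intro m σ
    have hs := scale_pos m
    have h3 := scale_lt_half m
    rw [observationScale, pow_succ, mul_comm]
    exact mul_le_mul (ih _ _) (by linarith) (by positivity) (by positivity)

theorem isScaleSeq_observationScale (m : ℕ) (σ : ℕ → Bool) :
    IsScaleSeq fun n => observationScale n m σ where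
  pos n := observationScale_pos n m σ
  strictAnti := strictAnti_nat_of_succ_lt fun n => observationScale_succ_lt n m σ
  tendsto_zero := squeeze_zero (fun n => (observationScale_pos n m σ).le)
    (fun n => observationScale_le_pow n m σ)
    (tendsto_pow_atTop_nhds_zero_of_lt_one (by norm_num) (by norm_num))

/-- The point `n` generations down stays in the unit disc of its own generation. -/
theorem norm_cantorPoint_add_observationScale_le (n m : ℕ) (σ : ℕ → Bool) :
    ‖cantorPoint m σ + observationScale n m σ‖ ≤ 1 :=
  (norm_le_of_le_exitTime (scale_pos m) (norm_cantorPoint_lt m σ)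
    (observationScale_pos n m σ).le (observationScale_le_exitTime n m σ)).trans (scale_le_one m)

theorem abs_log_sub_log_le {x r : ℝ} (hr : 0 < r) (h1 : r / 4 ≤ x) (h2 : x ≤ 4 * r) :
    |Real.log x - Real.log r| ≤ Real.log 4 := by
  have hx : 0 < x := lt_of_lt_of_le (by positivity) h1
  rw [abs_le]
  constructor
  · have := Real.log_le_log (by positivity) h1
    rw [Real.log_div hr.ne' (by norm_num)] at this
    linarith
  · have := Real.log_le_log hx h2
    rw [Real.log_mul (by norm_num) hr.ne'] at this
    linarith

theorem abs_log_observationScale_sub_le (n : ℕ) : ∀ (m : ℕ) (σ : ℕ → Bool),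
    |Real.log (observationScale n m σ) - logScaleSum n m| ≤ Real.log 4 * (n + 1) := by
  induction n with
  | zero =>
    intro m σ
    have h1 := exitTime_le (scale_pos m) (norm_cantorPoint_lt m σ)
    have h4 := le_exitTime (scale_pos m) (norm_cantorPoint_lt m σ)
    have h2 := norm_cantorPoint_le m σ
    have := scale_pos m
    rw [logScaleSum_zero, observationScale]
    refine (abs_log_sub_log_le (scale_pos m) (by linarith) (by linarith)).trans_eq (by simp)
  | succ n ih =>
    intro m σ
    have h1 := ih (m + 1) fun k => σ (k + 1)
    have h2 := observationScale_pos n (m + 1) fun k => σ (k + 1)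
    have hs := scale_pos m
    have h3 : (0 : ℝ) ≤ Real.log 4 := Real.log_nonneg (by norm_num)
    rw [observationScale, logScaleSum_succ, Real.log_mul (by positivity) h2.ne',
      Real.log_div hs.ne' (by norm_num)]
    rw [abs_le] at h1 ⊢
    push_cast
    constructor <;> nlinarith

/-! ### Stretching and rotation along the observation scales -/

namespace IsPlantedFamily

variable {b : ℂ} {f : ℕ → ℂ → ℂ}

/-- Each generation contributes `(b.re + 1) log (scale m)` to the logarithm of the distance, up to the
factor `4` between the linear disc and the child. -/
theorem abs_log_norm_sub_le (h : IsPlantedFamily b f) (hb : -1 < b.re) (n : ℕ) :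
    ∀ (m : ℕ) (σ : ℕ → Bool),
      |Real.log ‖f m (cantorPoint m σ + observationScale n m σ) - f m (cantorPoint m σ)‖
        - (b.re + 1) * logScaleSum n m| ≤ Real.log 4 * (n + 1) := by
  have hlog : ∀ m, Real.log (‖multiplier b m‖ * scale m) = (b.re + 1) * Real.log (scale m) :=
    fun m => by rw [norm_multiplier_mul_scale, Real.log_exp]
  induction n with
  | zero =>
    intro m σ
    have hs := scale_pos m
    have hln : 0 < ‖multiplier b m‖ := norm_pos_iff.2 (multiplier_ne_zero b m)
    have hzs := norm_cantorPoint_lt m σ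
    obtain ⟨p, hp, hpn⟩ := h.apply_cantorPoint hb m σ
    have hn := norm_add_exitTime hs hzs
    have hft : f m (cantorPoint m σ + exitTime (scale m) (cantorPoint m σ))
        = multiplier b m * (cantorPoint m σ + exitTime (scale m) (cantorPoint m σ)) := by
      rw [h.eq_radialStretch hb fun ε => (one_lt_norm_childCoord (by rw [hn]; linarith) ε).le,
        radialStretch_of_le (scale_le_one m) hn.le, multiplier, mul_comm]
    rw [logScaleSum_zero, ← hlog, observationScale, hft, hp, ← mul_sub, norm_mul]
    set w := cantorPoint m σ + exitTime (scale m) (cantorPoint m σ)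
    have h1 := norm_sub_norm_le w p
    have h2 := norm_sub_le w p
    rw [hn] at h1 h2
    refine (abs_log_sub_log_le (by positivity) ?_ ?_).trans_eq (by simp)
    · rw [mul_div_assoc]
      gcongr
      linarith
    · rw [mul_left_comm]
      gcongr
      linarith
  | succ n ih =>
    intro m σ
    have h1 := ih (m + 1) fun k => σ (k + 1)
    have h2 := observationScale_pos n (m + 1) fun k => σ (k + 1)
    have hs := scale_pos m
    have hln : 0 < ‖multiplier b m‖ := norm_pos_iff.2 (multiplier_ne_zero b m)
    have h3 : (0 : ℝ) ≤ Real.log 4 := Real.log_nonneg (by norm_num)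
    have h4 := h.apply_add_sub_of_child hb m σ
      (norm_cantorPoint_add_observationScale_le n (m + 1) fun k => σ (k + 1))
    have h5 : 0 < ‖f (m + 1) (cantorPoint (m + 1) (fun k => σ (k + 1))
        + observationScale n (m + 1) fun k => σ (k + 1))
        - f (m + 1) (cantorPoint (m + 1) fun k => σ (k + 1))‖ := by
      refine norm_pos_iff.2 fun hc => ?_
      have := h.injective hb (m + 1) (sub_eq_zero.1 hc)
      simp only [add_eq_left, Complex.ofReal_eq_zero] at this
      exact h2.ne' this
    have h6 : Real.log (‖multiplier b m‖ * (scale m / 4))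
        = (b.re + 1) * Real.log (scale m) - Real.log 4 := by
      rw [← hlog, ← Real.log_div (by positivity) (by norm_num), mul_div_assoc]
    rw [observationScale, h4, norm_mul, norm_mul, Complex.norm_real,
      Real.norm_of_nonneg (by positivity), Real.log_mul (by positivity) h5.ne', h6, logScaleSum_succ]
    rw [abs_le] at h1 ⊢
    push_cast
    constructor <;> nlinarith

/-- Passing to a child changes the argument along the ray by a constant, which is the rotation of
one spiral up to a bounded error. -/
theorem abs_rayArg_sub_rayArg_child_le (h : IsPlantedFamily b f) (hb : -1 < b.re) (m : ℕ)
    (σ : ℕ → Bool) {θ θ' : ℝ → ℝ} (hθ : IsRayArg (f m) (cantorPoint m σ) θ)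
    (hθ' : IsRayArg (f (m + 1)) (cantorPoint (m + 1) fun k => σ (k + 1)) θ') {s : ℝ} (hs0 : 0 < s)
    (hs : s ≤ exitTime 1 (cantorPoint (m + 1) fun k => σ (k + 1))) :
    |θ (scale m / 4 * s) - θ' s - b.im * Real.log (scale m)| ≤ 5 * Real.pi := by
  have hsc := scale_pos m
  have hzs : ‖cantorPoint m σ‖ < scale m := norm_cantorPoint_lt m σ
  set z' := cantorPoint (m + 1) fun k => σ (k + 1) with hz'
  have hz1 : ‖z'‖ < 1 := (norm_cantorPoint_lt _ _).trans_le (scale_le_one _)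
  set s₁ := exitTime 1 z' with hs₁
  have hln : 0 < ‖multiplier b m‖ := norm_pos_iff.2 (multiplier_ne_zero b m)
  have hint : ∀ s ∈ Set.Ioc 0 s₁, ∃ n : ℤ,
      θ (scale m / 4 * s) - θ' s - b.im * Real.log (scale m) = n * (2 * Real.pi) := by
    intro s hs
    have h1 := h.apply_add_sub_of_child hb m σ (norm_le_of_le_exitTime one_pos hz1 hs.1.le hs.2)
    have h2 := hθ.arg_eq (scale m / 4 * s) (mul_pos (by positivity) hs.1)
    have h3 := hθ'.arg_eq s hs.1
    have h5 : 0 < ‖f (m + 1) (z' + s) - f (m + 1) z'‖ := by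
      refine norm_pos_iff.2 fun hc => ?_
      have := h.injective hb (m + 1) (sub_eq_zero.1 hc)
      simp only [add_eq_left, Complex.ofReal_eq_zero] at this
      exact hs.1.ne' this
    have h6 : ‖f m (cantorPoint m σ + (scale m / 4 * s : ℝ)) - f m (cantorPoint m σ)‖
        = ‖multiplier b m‖ * (scale m / 4) * ‖f (m + 1) (z' + s) - f (m + 1) z'‖ := by
      rw [h1, norm_mul, norm_mul, Complex.norm_real, Real.norm_of_nonneg (by positivity)]
    rw [h6, h1] at h2
    set N := ‖f (m + 1) (z' + s) - f (m + 1) z'‖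
    rw [h3] at h2
    have hmul := multiplier_eq_norm_mul_exp b m
    have e : Complex.exp ((b.im * Real.log (scale m) : ℝ) * Complex.I + θ' s * Complex.I)
        = Complex.exp (θ (scale m / 4 * s) * Complex.I) := by
      have hlc : (‖multiplier b m‖ : ℂ) ≠ 0 := by exact_mod_cast hln.ne'
      have hNc : (N : ℂ) ≠ 0 := by exact_mod_cast h5.ne'
      have hsc' : (scale m : ℂ) ≠ 0 := by exact_mod_cast hsc.ne'
      rw [Complex.exp_add]
      have h7 : (‖multiplier b m‖ * (scale m / 4) * N : ℂ) ≠ 0 := by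
        refine mul_ne_zero (mul_ne_zero hlc ?_) hNc
        exact div_ne_zero hsc' (by norm_num)
      refine mul_left_cancel₀ h7 ?_
      push_cast at h2 hmul ⊢
      linear_combination h2 - hmul * (scale m / 4) * N * Complex.exp (θ' s * Complex.I)
    obtain ⟨n, hn⟩ := exists_int_of_exp_im e.symm
    refine ⟨n, ?_⟩
    rw [← hn]
    simp
    ring
  have hcont : ContinuousOn (fun s => θ (scale m / 4 * s) - θ' s - b.im * Real.log (scale m))
      (Set.Ioc 0 s₁) := by
    refine ((hθ.continuousOn.comp (by fun_prop) fun s hs => ?_).sub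
      (hθ'.continuousOn.mono fun s hs => hs.1)).sub continuousOn_const
    exact mul_pos (by positivity) hs.1
  have hs₁p : 0 < s₁ := exitTime_pos one_pos hz1
  -- the constant is evaluated on the boundary of the child
  have hconst := eq_of_forall_int_mul_two_pi isPreconnected_Ioc hcont hint
    (s := s) (t := s₁) ⟨hs0, hs⟩ ⟨hs₁p, le_rfl⟩
  beta_reduce at hconst
  rw [hconst]
  have a1 := h.abs_rayArg_sub_lt_pi hb m σ hθ
  have a2 := h.abs_rayArg_sub_le hb m σ hθ le_rfl
  rw [norm_add_exitTime hsc hzs, logClamp_of_le (scale_le_one m) le_rfl] at a2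
  have a3 := h.abs_rayArg_sub_le hb (m + 1) (fun k => σ (k + 1)) hθ'
    (exitTime_mono (scale_pos _).le (scale_le_one _) _)
  rw [norm_add_exitTime one_pos hz1, logClamp_of_one_le (scale_le_one _) le_rfl, mul_zero,
    sub_zero] at a3
  rw [abs_lt] at a1
  rw [abs_le] at a2 a3 ⊢
  constructor <;> linarith

theorem abs_rayArg_observationScale_sub_le (h : IsPlantedFamily b f) (hb : -1 < b.re) (n : ℕ) :
    ∀ (m : ℕ) (σ : ℕ → Bool) (θ : ℝ → ℝ), IsRayArg (f m) (cantorPoint m σ) θ →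
      |θ (observationScale n m σ) - b.im * logScaleSum n m| ≤ 5 * Real.pi * (n + 1) := by
  induction n with
  | zero =>
    intro m σ θ hθ
    have hs := scale_pos m
    have hzs := norm_cantorPoint_lt m σ
    have a2 := h.abs_rayArg_sub_le hb m σ hθ le_rfl
    rw [norm_add_exitTime hs hzs, logClamp_of_le (scale_le_one m) le_rfl] at a2
    rw [logScaleSum_zero, observationScale]
    refine a2.trans ?_
    have := Real.pi_pos
    simp
    linarith
  | succ n ih =>
    intro m σ θ hθ
    obtain ⟨θ', hθ'⟩ := exists_isRayArg (h.continuous (m + 1)) (h.injective hb (m + 1))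
      (fun z hz => h.eq_id hb hz) (cantorPoint (m + 1) fun k => σ (k + 1))
    have h1 := ih (m + 1) (fun k => σ (k + 1)) θ' hθ'
    have h2 := h.abs_rayArg_sub_rayArg_child_le hb m σ hθ hθ'
      (observationScale_pos n (m + 1) fun k => σ (k + 1))
      ((observationScale_le_exitTime _ _ _).trans
        (exitTime_mono (scale_pos _).le (scale_le_one _) _))
    rw [observationScale, logScaleSum_succ]
    rw [abs_le] at h1 h2 ⊢
    push_cast
    constructor <;> linarith

end IsPlantedFamily

theorem tendsto_div_logScaleSum {x : ℕ → ℝ} {a C : ℝ}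
    (hx : ∀ n, |x n - a * logScaleSum n 0| ≤ C * (n + 1)) :
    Tendsto (fun n => x n / logScaleSum n 0) atTop (𝓝 a) := by
  have hA : ∀ n : ℕ, logScaleSum n 0 = -((n + 1) * (n + 2) / 2) := fun n => by
    rw [logScaleSum]; push_cast; ring
  rw [tendsto_iff_norm_sub_tendsto_zero]
  have hb : ∀ n : ℕ, ‖x n / logScaleSum n 0 - a‖ ≤ 2 * C * (1 / ((n + 1 : ℕ) + 1 : ℝ)) := fun n => by
    have hpos : (0 : ℝ) < (n + 1) * (n + 2) / 2 := by positivity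
    have hne : logScaleSum n 0 ≠ 0 := by rw [hA]; exact neg_ne_zero.2 hpos.ne'
    have e : x n / logScaleSum n 0 - a = (x n - a * logScaleSum n 0) / logScaleSum n 0 := by
      field_simp
    rw [e, norm_div, Real.norm_eq_abs, Real.norm_eq_abs, div_le_iff₀ (abs_pos.2 hne)]
    refine (hx n).trans_eq ?_
    rw [hA, abs_neg, abs_of_pos hpos]
    push_cast
    field_simp
    ring
  refine squeeze_zero (fun n => norm_nonneg _) hb ?_
  have := ((tendsto_add_atTop_iff_nat 1).2
    (tendsto_one_div_add_atTop_nhds_zero_nat (𝕜 := ℝ))).const_mul (2 * C)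
  simpa using this

/-- The sum of the logarithms grows quadratically in the number of generations, so linear errors do
not affect the limit. -/
theorem tendsto_div_of_abs_sub_logScaleSum_le {x y : ℕ → ℝ} {a c C C' : ℝ} (hc : c ≠ 0)
    (hx : ∀ n, |x n - a * logScaleSum n 0| ≤ C * (n + 1))
    (hy : ∀ n, |y n - c * logScaleSum n 0| ≤ C' * (n + 1)) :
    Tendsto (fun n => x n / y n) atTop (𝓝 (a / c)) := by
  refine ((tendsto_div_logScaleSum hx).div (tendsto_div_logScaleSum hy) hc).congr fun n => ?_
  have : logScaleSum n 0 ≠ 0 := by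
    rw [logScaleSum]
    have : (0 : ℝ) ≤ n := n.cast_nonneg
    have : (0 : ℝ) < (n + 1) * ((0 : ℕ) + 1) + n * (n + 1) / 2 := by push_cast; positivity
    exact neg_ne_zero.2 this.ne'
  exact div_div_div_cancel_right₀ this _ _

theorem mainTheorem7 (K α γ : ℝ) (hK : QCMap.IsQuasiconformal K (QCMap.powerMap α γ)) :
    ∃ f : ℂ → ℂ, QCMap.IsQuasiconformal K f ∧ QCMap.IsPrincipal f ∧
      ∃ E : Set ℂ, ¬ E.Countable ∧
        ∀ z ∈ E, QCMap.StretchesAndRotatesLike f α γ z := by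
  set b : ℂ := α * (1 + Complex.I * γ) - 1 with hb
  have hα := exponent_pos_of_continuous_powerMap hK.isHomeomorph.continuous
  have hbre : b.re = α - 1 := by simp [hb]
  have hbim : b.im = α * γ := by simp [hb]
  have hb1 : -1 < b.re := by rw [hbre]; linarith
  obtain ⟨f, h⟩ := exists_isPlantedFamily hb1
  have hR := fun m => ae_hasDistortion_radialStretch hK (scale_pos m)
    (lt_of_lt_of_le (scale_lt_half m) (by norm_num))
  refine ⟨f 0, h.isQuasiconformal hb1 (hR 0).1 (fun m => (hR m).2) 0, h.isPrincipal hb1 0,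
    Set.range (cantorPoint 0), not_countable_range_cantorPoint 0, ?_⟩
  rintro _ ⟨σ, rfl⟩
  obtain ⟨θ, hθ⟩ := exists_isRayArg (h.continuous 0) (h.injective hb1 0)
    (fun z hz => h.eq_id hb1 hz) (cantorPoint 0 σ)
  have h1 := fun n => abs_log_observationScale_sub_le n 0 σ
  have h2 := fun n => h.abs_log_norm_sub_le hb1 n 0 σ
  have h3 := fun n => h.abs_rayArg_observationScale_sub_le hb1 n 0 σ θ hθ
  rw [hbre, sub_add_cancel] at h2
  rw [hbim] at h3
  refine ⟨fun n => observationScale n 0 σ, isScaleSeq_observationScale 0 σ, ?_, θ, hθ, ?_⟩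
  · have := tendsto_div_of_abs_sub_logScaleSum_le (a := α) (c := 1) one_ne_zero h2
      (fun n => by simpa using h1 n)
    rwa [div_one] at this
  · have := tendsto_div_of_abs_sub_logScaleSum_le (c := α) hα.ne' h3 h2
    rwa [mul_div_cancel_left₀ _ hα.ne'] at this
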